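/- Let $F$ be a field of odd prime characteristic $p$ and let $n_1,n_2$ be positive integers. Let $A=F[x,y;n_1,n_2]$ be the algebra of truncated divided powers, with basis the monomials $x^{(i)}y^{(j)}$, $0\le i<p^{n_1}$, $0\le j<p^{n_2}$, and product $x^{(i)}y^{(j)}\cdot x^{(k)}y^{(l)}=\binom{i+k}{i}\binom{j+l}{j}x^{(i+k)}y^{(j+l)}$ (monomials outside the range being zero). Put $\partial_x x^{(i)}y^{(j)}=x^{(i-1)}y^{(j)}$ and $\partial_y x^{(i)}y^{(j)}=x^{(i)}y^{(j-1)}$ (where $x^{(-1)}=y^{(-1)}=0$), let $W=\{f\partial_x+g\partial_y : f,g\in A\}$, and let $e=x^{(p^{n_1}-1)}y^{(p^{n_2}-1)}$ and $\omega_2=(1-e)\,dx\wedge dy$. Let $W$ act on differential 2-forms by $D(f\,dx\wedge dy)=(Df)\,dx\wedge dy+f\,d(Dx)\wedge dy+f\,dx\wedge d(Dy)$, where $dh=(\partial_x h)\,dx+(\partial_y h)\,dy$, let $\tilde H=\{D\in W : D\omega_2=0\}$, and let $L=H(2:\mathbf n;\omega_2)$ be the second derived algebra of the Lie algebra $\tilde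 H$. Then the derivations $(1+e)\bigl((\partial_y f)\,\partial_x-(\partial_x f)\,\partial_y\bigr)$, for $f=x^{(i)}y^{(j)}$ with $0\le i<p^{n_1}$, $0\le j<p^{n_2}$ and $(i,j)\ne(0,0)$, form a basis of $L$; write again $x^{(i)}y^{(j)}$ for the element of $L$ given by $f=x^{(i)}y^{(j)}$. For $0<r\le n_2$ and $0<s\le n_1$ the bilinear forms on $L$ defined on this basis by $$\varphi_r(x^{(i)}y^{(j)},x^{(k)}y^{(l)})=\begin{cases}(-1)^{i+j}&\text{if }(i+k,j+l)\equiv(0,p^r),\\0&\text{otherwise,}\end{cases}$$ $$\psi_s(x^{(i)}y^{(j)},x^{(k)}y^{(l)})=\begin{cases}(-1)^{i+j+1}&\text{if }(i+k,j+l)\equiv(p^s,0),\\0&\text{otherwise,}\end{cases}$$ where $\equiv$ denotes congruence in $\mathbb Z^2$ modulo the cyclic subgroup generated by $(p^{n_1}-1,\,p^{n_2}-1)$, are 2-cocycles of $L$ with values in the trivial module $F$, and the classes of the $\varphi_r$ ($0<r\le n_2$) and $\psi_s$ ($0<s\le n_1$) form a basis of the second cohomology group $H^2(L,F)$. In particular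 $\dim_F H^2(L,F)=n_1+n_2$. -/

import Mathlib

set_option maxSynthPendingDepth 3

namespace HamiltonianLie

open LieModule.Cohomology

section DividedPowers

/-- Underlying space of the algebra of divided powers in two variables `x`, `y`, truncated at
`x^(q₁)` and `y^(q₂)`: an element is the family of its coefficients with respect to the monomials
`x^(i) y^(j)`, `i < q₁`, `j < q₂`. -/
def TruncDP (F : Type*) (q₁ q₂ : ℕ) : Type _ := Fin q₁ × Fin q₂ → F

variable {F : Type*} [Field F] {q₁ q₂ : ℕ}

instance TruncDP.instAddCommGroup : AddCommGroup (TruncDP F q₁ q₂) :=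
  inferInstanceAs (AddCommGroup (Fin q₁ × Fin q₂ → F))

instance TruncDP.instModule : Module F (TruncDP F q₁ q₂) :=
  inferInstanceAs (Module F (Fin q₁ × Fin q₂ → F))

/-- The monomial `x^(i) y^(j)`; it is zero if `i ≥ q₁` or `j ≥ q₂`. -/
def mon (F : Type*) [Field F] (q₁ q₂ i j : ℕ) : TruncDP F q₁ q₂ :=
  fun u => if (u.1 : ℕ) = i ∧ (u.2 : ℕ) = j then 1 else 0

/-- The monomials `x^(i) y^(j)` with `i < q₁` and `j < q₂` are a basis. -/
noncomputable def monBasis (F : Type*) [Field F] (q₁ q₂ : ℕ) :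
    Module.Basis (Fin q₁ × Fin q₂) F (TruncDP F q₁ q₂) :=
  Pi.basisFun F (Fin q₁ × Fin q₂)

lemma monBasis_apply (u : Fin q₁ × Fin q₂) : monBasis F q₁ q₂ u = mon F q₁ q₂ u.1 u.2 := by
  classical
  refine (Pi.basisFun_apply F (Fin q₁ × Fin q₂) u).trans ?_
  funext v
  simp only [Pi.single_apply, mon, Prod.ext_iff, Fin.ext_iff]

lemma mon_eq_zero {i j : ℕ} (h : q₁ ≤ i ∨ q₂ ≤ j) : mon F q₁ q₂ i j = 0 := by
  funext u
  have h1 := u.1.2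
  have h2 := u.2.2
  have : ¬ ((u.1 : ℕ) = i ∧ (u.2 : ℕ) = j) := by omega
  simp only [mon, this, if_false]
  rfl

lemma mon_ext {M : Type*} [AddCommGroup M] [Module F M] {f g : TruncDP F q₁ q₂ →ₗ[F] M}
    (h : ∀ i j, i < q₁ → j < q₂ → f (mon F q₁ q₂ i j) = g (mon F q₁ q₂ i j)) : f = g := by
  refine (monBasis F q₁ q₂).ext fun u => ?_
  rw [monBasis_apply]
  exact h _ _ u.1.2 u.2.2

/-- The bilinear product with
`x^(i) y^(j) * x^(k) y^(l) = (i+k choose i) (j+l choose j) x^(i+k) y^(j+l)`. -/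
noncomputable def mulLin (F : Type*) [Field F] (q₁ q₂ : ℕ) :
    TruncDP F q₁ q₂ →ₗ[F] TruncDP F q₁ q₂ →ₗ[F] TruncDP F q₁ q₂ :=
  (monBasis F q₁ q₂).constr F fun u => (monBasis F q₁ q₂).constr F fun v =>
    (((u.1 + v.1 : ℕ).choose u.1 * (u.2 + v.2 : ℕ).choose u.2 : ℕ) : F) •
      mon F q₁ q₂ (u.1 + v.1) (u.2 + v.2)

lemma mulLin_mon (i j k l : ℕ) :
    mulLin F q₁ q₂ (mon F q₁ q₂ i j) (mon F q₁ q₂ k l) =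
      (((i + k).choose i * (j + l).choose j : ℕ) : F) • mon F q₁ q₂ (i + k) (j + l) := by
  by_cases h : q₁ ≤ i ∨ q₂ ≤ j
  · rw [mon_eq_zero h, mon_eq_zero (show q₁ ≤ i + k ∨ q₂ ≤ j + l by omega)]
    simp
  by_cases h' : q₁ ≤ k ∨ q₂ ≤ l
  · rw [mon_eq_zero h', mon_eq_zero (show q₁ ≤ i + k ∨ q₂ ≤ j + l by omega)]
    simp
  push Not at h h'
  have e1 := monBasis_apply (F := F) ((⟨i, h.1⟩, ⟨j, h.2⟩) : Fin q₁ × Fin q₂)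
  have e2 := monBasis_apply (F := F) ((⟨k, h'.1⟩, ⟨l, h'.2⟩) : Fin q₁ × Fin q₂)
  simp only at e1 e2
  rw [← e1, ← e2, mulLin, Module.Basis.constr_basis, Module.Basis.constr_basis]

lemma mulLin_comm (f g : TruncDP F q₁ q₂) : mulLin F q₁ q₂ f g = mulLin F q₁ q₂ g f := by
  have : mulLin F q₁ q₂ = (mulLin F q₁ q₂).flip := by
    refine mon_ext fun i j _ _ => mon_ext fun k l _ _ => ?_
    rw [LinearMap.flip_apply, mulLin_mon, mulLin_mon, add_comm k i, add_comm l j,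
      Nat.choose_symm_add, Nat.choose_symm_add]
  exact congrArg (fun m => m f g) this

lemma mon_induction {P : TruncDP F q₁ q₂ → Prop} (f : TruncDP F q₁ q₂) (h_zero : P 0)
    (h_add : ∀ g h, P g → P h → P (g + h)) (h_smul : ∀ (c : F) g, P g → P (c • g))
    (h_mon : ∀ i j, i < q₁ → j < q₂ → P (mon F q₁ q₂ i j)) : P f := by
  have hf : f ∈ Submodule.span F (Set.range (monBasis F q₁ q₂)) := by
    rw [(monBasis F q₁ q₂).span_eq]
    exact Submodule.mem_top
  induction hf using Submodule.span_induction with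
  | mem g hg =>
    obtain ⟨u, rfl⟩ := hg
    rw [monBasis_apply]
    exact h_mon _ _ u.1.2 u.2.2
  | zero => exact h_zero
  | add g h _ _ hg hh => exact h_add g h hg hh
  | smul c g _ hg => exact h_smul c g hg

lemma mulLin_assoc (f g h : TruncDP F q₁ q₂) :
    mulLin F q₁ q₂ (mulLin F q₁ q₂ f g) h = mulLin F q₁ q₂ f (mulLin F q₁ q₂ g h) := by
  have choose_assoc : ∀ a b c : ℕ, (a + b).choose a * (a + b + c).choose (a + b) =
      (b + c).choose b * (a + (b + c)).choose a := by
    intro a b c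
    have := Nat.choose_mul (n := a + b + c) (k := a + b) (s := a) (by omega)
    rw [show a + b + c - a = b + c by omega, show a + b - a = b by omega] at this
    rw [← add_assoc, mul_comm, this, mul_comm]
  induction f using mon_induction with
  | h_zero => simp
  | h_add f₁ f₂ h₁ h₂ => simp [h₁, h₂]
  | h_smul c f₁ h₁ => simp [h₁]
  | h_mon i j _ _ =>
    induction g using mon_induction with
    | h_zero => simp
    | h_add f₁ f₂ h₁ h₂ => simp [h₁, h₂]
    | h_smul c f₁ h₁ => simp [h₁]
    | h_mon k l _ _ =>
      induction h using mon_induction with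
      | h_zero => simp
      | h_add f₁ f₂ h₁ h₂ => simp [h₁, h₂]
      | h_smul c f₁ h₁ => simp [h₁]
      | h_mon r s _ _ =>
        simp only [mulLin_mon, map_smul, LinearMap.smul_apply, smul_smul, ← Nat.cast_mul]
        rw [← add_assoc i k r, ← add_assoc j l s]
        congr 2
        have e1 := choose_assoc i k r
        have e2 := choose_assoc j l s
        rw [← add_assoc] at e1 e2
        calc _ = ((i + k).choose i * (i + k + r).choose (i + k)) *
              ((j + l).choose j * (j + l + s).choose (j + l)) := by ring
          _ = _ := by rw [e1, e2]; ring

lemma mulLin_one (f : TruncDP F q₁ q₂) : mulLin F q₁ q₂ f (mon F q₁ q₂ 0 0) = f := by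
  induction f using mon_induction with
  | h_zero => simp
  | h_add f₁ f₂ h₁ h₂ => simp [h₁, h₂]
  | h_smul c f₁ h₁ => simp [h₁]
  | h_mon i j _ _ => simp [mulLin_mon]

noncomputable instance TruncDP.instCommRing : CommRing (TruncDP F q₁ q₂) :=
  { TruncDP.instAddCommGroup with
    mul f g := mulLin F q₁ q₂ f g
    one := mon F q₁ q₂ 0 0
    mul_comm := mulLin_comm
    mul_assoc := mulLin_assoc
    one_mul f := (mulLin_comm _ _).trans (mulLin_one f)
    mul_one := mulLin_one
    left_distrib f g h := map_add _ g h
    right_distrib f g h := LinearMap.map_add₂ _ f g h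
    zero_mul f := LinearMap.map_zero₂ _ f
    mul_zero f := map_zero _ }

lemma mul_def (f g : TruncDP F q₁ q₂) : f * g = mulLin F q₁ q₂ f g := rfl

lemma one_def : (1 : TruncDP F q₁ q₂) = mon F q₁ q₂ 0 0 := rfl

noncomputable instance TruncDP.instAlgebra : Algebra F (TruncDP F q₁ q₂) :=
  Algebra.ofModule (fun c f g => LinearMap.map_smul₂ _ c f g) (fun c _ g => map_smul _ c g)

lemma mon_mul_mon (i j k l : ℕ) :
    mon F q₁ q₂ i j * mon F q₁ q₂ k l =
      (((i + k).choose i * (j + l).choose j : ℕ) : F) • mon F q₁ q₂ (i + k) (j + l) :=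
  mulLin_mon i j k l

/-- The linear map with `x^(i) y^(j) ↦ x^(i-1) y^(j)`, where `x^(-1) = 0`. -/
noncomputable def dxLin (F : Type*) [Field F] (q₁ q₂ : ℕ) :
    TruncDP F q₁ q₂ →ₗ[F] TruncDP F q₁ q₂ :=
  (monBasis F q₁ q₂).constr F fun u =>
    if (u.1 : ℕ) = 0 then 0 else mon F q₁ q₂ (u.1 - 1) u.2

/-- The linear map with `x^(i) y^(j) ↦ x^(i) y^(j-1)`, where `y^(-1) = 0`. -/
noncomputable def dyLin (F : Type*) [Field F] (q₁ q₂ : ℕ) :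
    TruncDP F q₁ q₂ →ₗ[F] TruncDP F q₁ q₂ :=
  (monBasis F q₁ q₂).constr F fun u =>
    if (u.2 : ℕ) = 0 then 0 else mon F q₁ q₂ u.1 (u.2 - 1)

lemma dxLin_mon {i j : ℕ} (hi : i < q₁) :
    dxLin F q₁ q₂ (mon F q₁ q₂ i j) = if i = 0 then 0 else mon F q₁ q₂ (i - 1) j := by
  by_cases hj : j < q₂
  · have e1 := monBasis_apply (F := F) ((⟨i, hi⟩, ⟨j, hj⟩) : Fin q₁ × Fin q₂)
    simp only at e1
    rw [← e1, dxLin, Module.Basis.constr_basis]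
  · rw [mon_eq_zero (i := i) (by omega), mon_eq_zero (i := i - 1) (by omega)]
    simp

lemma dyLin_mon {i j : ℕ} (hj : j < q₂) :
    dyLin F q₁ q₂ (mon F q₁ q₂ i j) = if j = 0 then 0 else mon F q₁ q₂ i (j - 1) := by
  by_cases hi : i < q₁
  · have e1 := monBasis_apply (F := F) ((⟨i, hi⟩, ⟨j, hj⟩) : Fin q₁ × Fin q₂)
    simp only at e1
    rw [← e1, dyLin, Module.Basis.constr_basis]
  · rw [mon_eq_zero (i := i) (j := j) (by omega), mon_eq_zero (i := i) (by omega)]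
    simp

end DividedPowers

section Derivations

variable (F : Type*) [Field F] (p n₁ n₂ : ℕ)

/-- The algebra `F[x, y; n₁, n₂]` of divided powers in two variables, of heights `n₁`, `n₂`, over a
field of characteristic `p`. Setting the monomials outside the range to zero is consistent with the
product formula: `(i+k choose i)` is zero in `F` if `i, k < p^n ≤ i + k`. -/
abbrev DP : Type _ := TruncDP F (p ^ n₁) (p ^ n₂)

variable [Fact p.Prime] [CharP F p]

lemma dxLin_leibniz (f g : DP F p n₁ n₂) :
    dxLin F (p ^ n₁) (p ^ n₂) (f * g) =
      f • dxLin F (p ^ n₁) (p ^ n₂) g + g • dxLin F (p ^ n₁) (p ^ n₂) f := by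
  have hp : p.Prime := Fact.out
  simp only [smul_eq_mul]
  induction f using mon_induction with
  | h_zero => simp
  | h_add f₁ f₂ h₁ h₂ => simp only [add_mul, mul_add, map_add, h₁, h₂]; ring
  | h_smul c f₁ h₁ => simp only [smul_mul_assoc, map_smul, h₁, smul_add, mul_smul_comm]
  | h_mon i j hi hj =>
    induction g using mon_induction with
    | h_zero => simp
    | h_add f₁ f₂ h₁ h₂ => simp only [add_mul, mul_add, map_add, h₁, h₂]; ring
    | h_smul c f₁ h₁ => simp only [smul_mul_assoc, map_smul, h₁, smul_add, mul_smul_comm]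
    | h_mon k l hk hl =>
      have key : (((i + k).choose i * (j + l).choose j : ℕ) : F) •
          dxLin F (p ^ n₁) (p ^ n₂) (mon F (p ^ n₁) (p ^ n₂) (i + k) (j + l)) =
          (((i + k).choose i * (j + l).choose j : ℕ) : F) •
          (if i + k = 0 then 0 else mon F (p ^ n₁) (p ^ n₂) (i + k - 1) (j + l)) := by
        rcases lt_trichotomy (i + k) (p ^ n₁) with h | h | h
        · rw [dxLin_mon h]
        · have : (((i + k).choose i : ℕ) : F) = 0 := by
            rw [CharP.cast_eq_zero_iff F p, h]
            exact hp.dvd_choose_pow (by omega) (by omega)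
          simp [this]
        · rw [mon_eq_zero (i := i + k) (by omega), mon_eq_zero (i := i + k - 1) (by omega)]
          simp
      rw [mon_mul_mon, map_smul, key, dxLin_mon hi, dxLin_mon hk]
      rcases i with _ | i <;> rcases k with _ | k
      · simp
      · simp [mon_mul_mon]
      · have e0 : (j + l).choose l = (j + l).choose j := Nat.choose_symm_of_eq_add (by omega)
        simp [mon_mul_mon, add_comm l j, e0]
      · have e1 : i + 1 + (k + 1) - 1 = i + k + 1 := by omega
        simp only [Nat.add_eq_zero_iff, one_ne_zero, and_false, if_false, mon_mul_mon, e1,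
          Nat.add_sub_cancel, and_self]
        rw [show i + 1 + k = i + k + 1 by omega, show k + 1 + i = i + k + 1 by omega, add_comm l j,
          ← add_smul]
        congr 1
        rw [← Nat.cast_add, show i + 1 + (k + 1) = i + k + 1 + 1 by omega,
          Nat.choose_succ_succ (i + k + 1) i,
          show (i + k + 1).choose (k + 1) = (i + k + 1).choose i from
            Nat.choose_symm_of_eq_add (by omega),
          show (j + l).choose l = (j + l).choose j from Nat.choose_symm_of_eq_add (by omega)]
        congr 1
        ring

lemma dyLin_leibniz (f g : DP F p n₁ n₂) :
    dyLin F (p ^ n₁) (p ^ n₂) (f * g) =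
      f • dyLin F (p ^ n₁) (p ^ n₂) g + g • dyLin F (p ^ n₁) (p ^ n₂) f := by
  have hp : p.Prime := Fact.out
  simp only [smul_eq_mul]
  induction f using mon_induction with
  | h_zero => simp
  | h_add f₁ f₂ h₁ h₂ => simp only [add_mul, mul_add, map_add, h₁, h₂]; ring
  | h_smul c f₁ h₁ => simp only [smul_mul_assoc, map_smul, h₁, smul_add, mul_smul_comm]
  | h_mon j i hj hi =>
    induction g using mon_induction with
    | h_zero => simp
    | h_add f₁ f₂ h₁ h₂ => simp only [add_mul, mul_add, map_add, h₁, h₂]; ring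
    | h_smul c f₁ h₁ => simp only [smul_mul_assoc, map_smul, h₁, smul_add, mul_smul_comm]
    | h_mon l k hl hk =>
      have key : (((j + l).choose j * (i + k).choose i : ℕ) : F) •
          dyLin F (p ^ n₁) (p ^ n₂) (mon F (p ^ n₁) (p ^ n₂) (j + l) (i + k)) =
          (((j + l).choose j * (i + k).choose i : ℕ) : F) •
          (if i + k = 0 then 0 else mon F (p ^ n₁) (p ^ n₂) (j + l) (i + k - 1)) := by
        rcases lt_trichotomy (i + k) (p ^ n₂) with h | h | h
        · rw [dyLin_mon h]
        · have : (((i + k).choose i : ℕ) : F) = 0 := by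
            rw [CharP.cast_eq_zero_iff F p, h]
            exact hp.dvd_choose_pow (by omega) (by omega)
          simp [this]
        · rw [mon_eq_zero (j := i + k) (by omega), mon_eq_zero (j := i + k - 1) (by omega)]
          simp
      rw [mon_mul_mon, map_smul, key, dyLin_mon hi, dyLin_mon hk]
      rcases i with _ | i <;> rcases k with _ | k
      · simp
      · simp [mon_mul_mon]
      · have e0 : (j + l).choose l = (j + l).choose j := Nat.choose_symm_of_eq_add (by omega)
        simp [mon_mul_mon, add_comm l j, e0]
      · have e1 : i + 1 + (k + 1) - 1 = i + k + 1 := by omega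
        simp only [Nat.add_eq_zero_iff, one_ne_zero, and_false, if_false, mon_mul_mon, e1,
          Nat.add_sub_cancel, and_self]
        rw [show i + 1 + k = i + k + 1 by omega, show k + 1 + i = i + k + 1 by omega, add_comm l j,
          ← add_smul]
        congr 1
        rw [← Nat.cast_add, show i + 1 + (k + 1) = i + k + 1 + 1 by omega,
          Nat.choose_succ_succ (i + k + 1) i,
          show (i + k + 1).choose (k + 1) = (i + k + 1).choose i from
            Nat.choose_symm_of_eq_add (by omega),
          show (j + l).choose l = (j + l).choose j from Nat.choose_symm_of_eq_add (by omega)]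
        congr 1
        ring

/-- The derivation `∂/∂x` of `F[x, y; n₁, n₂]`. -/
noncomputable def dx : Derivation F (DP F p n₁ n₂) (DP F p n₁ n₂) :=
  Derivation.mk' (dxLin F (p ^ n₁) (p ^ n₂)) (dxLin_leibniz F p n₁ n₂)

/-- The derivation `∂/∂y` of `F[x, y; n₁, n₂]`. -/
noncomputable def dy : Derivation F (DP F p n₁ n₂) (DP F p n₁ n₂) :=
  Derivation.mk' (dyLin F (p ^ n₁) (p ^ n₂)) (dyLin_leibniz F p n₁ n₂)

lemma dx_mon {i j : ℕ} (hi : i < p ^ n₁) : dx F p n₁ n₂ (mon F (p ^ n₁) (p ^ n₂) i j) =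
    if i = 0 then 0 else mon F (p ^ n₁) (p ^ n₂) (i - 1) j :=
  dxLin_mon hi

lemma dy_mon {i j : ℕ} (hj : j < p ^ n₂) : dy F p n₁ n₂ (mon F (p ^ n₁) (p ^ n₂) i j) =
    if j = 0 then 0 else mon F (p ^ n₁) (p ^ n₂) i (j - 1) :=
  dyLin_mon hj

lemma dx_dy_comm (f : DP F p n₁ n₂) :
    dx F p n₁ n₂ (dy F p n₁ n₂ f) = dy F p n₁ n₂ (dx F p n₁ n₂ f) := by
  induction f using mon_induction with
  | h_zero => simp
  | h_add f₁ f₂ h₁ h₂ => simp only [map_add, h₁, h₂]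
  | h_smul c f₁ h₁ => simp only [Derivation.map_smul, h₁]
  | h_mon i j hi hj =>
    rw [dx_mon F p n₁ n₂ hi, dy_mon F p n₁ n₂ hj]
    have hp : 0 < p := (Fact.out : p.Prime).pos
    have h1 : 0 < p ^ n₁ := by positivity
    have h2 : 0 < p ^ n₂ := by positivity
    split_ifs <;> simp [dx_mon F p n₁ n₂ hi, dy_mon F p n₁ n₂ hj, dx_mon F p n₁ n₂ h1,
      dy_mon F p n₁ n₂ h2, *]

/-- `W(2 : n)`: the Lie algebra of special derivations `f ∂/∂x + g ∂/∂y` of `F[x, y; n₁, n₂]`. -/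
noncomputable def W : LieSubalgebra F (Derivation F (DP F p n₁ n₂) (DP F p n₁ n₂)) where
  carrier := {D | ∃ f g : DP F p n₁ n₂, D = f • dx F p n₁ n₂ + g • dy F p n₁ n₂}
  zero_mem' := ⟨0, 0, by simp⟩
  add_mem' := by
    rintro _ _ ⟨f, g, rfl⟩ ⟨f', g', rfl⟩
    exact ⟨f + f', g + g', by simp only [add_smul]; abel⟩
  smul_mem' := by
    rintro c _ ⟨f, g, rfl⟩
    exact ⟨c • f, c • g, by simp only [smul_add, smul_assoc]⟩
  lie_mem' := by
    rintro _ _ ⟨f, g, rfl⟩ ⟨f', g', rfl⟩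
    refine ⟨f * dx F p n₁ n₂ f' + g * dy F p n₁ n₂ f' -
        (f' * dx F p n₁ n₂ f + g' * dy F p n₁ n₂ f),
      f * dx F p n₁ n₂ g' + g * dy F p n₁ n₂ g' -
        (f' * dx F p n₁ n₂ g + g' * dy F p n₁ n₂ g), ?_⟩
    refine Derivation.ext fun h => ?_
    simp only [Derivation.commutator_apply, Derivation.add_apply, Derivation.smul_apply,
      smul_eq_mul, map_add, Derivation.leibniz, dx_dy_comm]
    ring

/-- The coefficient of `D(f dx ∧ dy)` with respect to `dx ∧ dy`, for `D` in `W(2 : n)`. Indeed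
`D(f dx ∧ dy) = (D f) dx ∧ dy + f d(D x) ∧ dy + f dx ∧ d(D y)`, where
`d h = (∂h/∂x) dx + (∂h/∂y) dy`, and 2-forms are a free module on `dx ∧ dy`. -/
noncomputable def formAction (D : Derivation F (DP F p n₁ n₂) (DP F p n₁ n₂)) (f : DP F p n₁ n₂) :
    DP F p n₁ n₂ :=
  D f + f * dx F p n₁ n₂ (D (mon F (p ^ n₁) (p ^ n₂) 1 0)) +
    f * dy F p n₁ n₂ (D (mon F (p ^ n₁) (p ^ n₂) 0 1))

/-- The element `e = x^(p^n₁ - 1) y^(p^n₂ - 1)`. -/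
noncomputable def topMon : DP F p n₁ n₂ := mon F (p ^ n₁) (p ^ n₂) (p ^ n₁ - 1) (p ^ n₂ - 1)

lemma dx_x_smul : dx F p n₁ n₂ (mon F (p ^ n₁) (p ^ n₂) 1 0) • dx F p n₁ n₂ = dx F p n₁ n₂ := by
  rcases Nat.lt_or_ge 1 (p ^ n₁) with h | h
  · rw [dx_mon F p n₁ n₂ h, if_neg one_ne_zero, Nat.sub_self, ← one_def, one_smul]
  · have h0 : ∀ g : DP F p n₁ n₂, dx F p n₁ n₂ g = 0 := by
      intro g
      induction g using mon_induction with
      | h_zero => simp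
      | h_add f₁ f₂ h₁ h₂ => simp only [map_add, h₁, h₂, add_zero]
      | h_smul c f₁ h₁ => simp only [Derivation.map_smul, h₁, smul_zero]
      | h_mon i j hi hj => rw [dx_mon F p n₁ n₂ hi, if_pos (by omega)]
    refine Derivation.ext fun g => ?_
    simp [h0]

lemma dy_y_smul : dy F p n₁ n₂ (mon F (p ^ n₁) (p ^ n₂) 0 1) • dy F p n₁ n₂ = dy F p n₁ n₂ := by
  rcases Nat.lt_or_ge 1 (p ^ n₂) with h | h
  · rw [dy_mon F p n₁ n₂ h, if_neg one_ne_zero, Nat.sub_self, ← one_def, one_smul]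
  · have h0 : ∀ g : DP F p n₁ n₂, dy F p n₁ n₂ g = 0 := by
      intro g
      induction g using mon_induction with
      | h_zero => simp
      | h_add f₁ f₂ h₁ h₂ => simp only [map_add, h₁, h₂, add_zero]
      | h_smul c f₁ h₁ => simp only [Derivation.map_smul, h₁, smul_zero]
      | h_mon i j hi hj => rw [dy_mon F p n₁ n₂ hj, if_pos (by omega)]
    refine Derivation.ext fun g => ?_
    simp [h0]

lemma eq_of_mem_W {D : Derivation F (DP F p n₁ n₂) (DP F p n₁ n₂)} (hD : D ∈ W F p n₁ n₂) :
    D = D (mon F (p ^ n₁) (p ^ n₂) 1 0) • dx F p n₁ n₂ +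
      D (mon F (p ^ n₁) (p ^ n₂) 0 1) • dy F p n₁ n₂ := by
  have hp : 0 < p := (Fact.out : p.Prime).pos
  obtain ⟨f, g, rfl⟩ := hD
  have e1 : dy F p n₁ n₂ (mon F (p ^ n₁) (p ^ n₂) 1 0) = 0 := by
    rw [dy_mon F p n₁ n₂ (by positivity), if_pos rfl]
  have e2 : dx F p n₁ n₂ (mon F (p ^ n₁) (p ^ n₂) 0 1) = 0 := by
    rw [dx_mon F p n₁ n₂ (by positivity), if_pos rfl]
  simp only [Derivation.add_apply, Derivation.smul_apply, e1, e2, smul_zero, add_zero, zero_add,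
    smul_assoc, dx_x_smul, dy_y_smul]

lemma formAction_lie {D E : Derivation F (DP F p n₁ n₂) (DP F p n₁ n₂)} (hD : D ∈ W F p n₁ n₂)
    (hE : E ∈ W F p n₁ n₂) (f : DP F p n₁ n₂) :
    formAction F p n₁ n₂ ⁅D, E⁆ f = formAction F p n₁ n₂ D (formAction F p n₁ n₂ E f) -
      formAction F p n₁ n₂ E (formAction F p n₁ n₂ D f) := by
  have h1 : ∀ h, D h = D (mon F (p ^ n₁) (p ^ n₂) 1 0) * dx F p n₁ n₂ h +
      D (mon F (p ^ n₁) (p ^ n₂) 0 1) * dy F p n₁ n₂ h := fun h =>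
    congrArg (fun D' => D' h) (eq_of_mem_W F p n₁ n₂ hD)
  have h2 : ∀ h, E h = E (mon F (p ^ n₁) (p ^ n₂) 1 0) * dx F p n₁ n₂ h +
      E (mon F (p ^ n₁) (p ^ n₂) 0 1) * dy F p n₁ n₂ h := fun h =>
    congrArg (fun D' => D' h) (eq_of_mem_W F p n₁ n₂ hE)
  simp only [formAction, Derivation.commutator_apply]
  generalize D (mon F (p ^ n₁) (p ^ n₂) 1 0) = a at *
  generalize D (mon F (p ^ n₁) (p ^ n₂) 0 1) = b at *
  generalize E (mon F (p ^ n₁) (p ^ n₂) 1 0) = c at *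
  generalize E (mon F (p ^ n₁) (p ^ n₂) 0 1) = d at *
  simp only [h1, h2, map_add, map_sub, Derivation.leibniz, smul_eq_mul, dx_dy_comm]
  ring

/-- `H̃(2 : n; ω₂) = {D ∈ W(2 : n) | D ω₂ = 0}`, where `ω₂ = (1 - e) dx ∧ dy`. -/
noncomputable def HTilde : LieSubalgebra F (Derivation F (DP F p n₁ n₂) (DP F p n₁ n₂)) where
  carrier := {D | D ∈ W F p n₁ n₂ ∧ formAction F p n₁ n₂ D (1 - topMon F p n₁ n₂) = 0}
  zero_mem' := ⟨zero_mem _, by simp [formAction]⟩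
  add_mem' := by
    rintro D E ⟨hD, hD'⟩ ⟨hE, hE'⟩
    refine ⟨add_mem hD hE, ?_⟩
    rw [← add_zero (0 : DP F p n₁ n₂)]
    nth_rw 1 [← hD']
    rw [← hE']
    simp only [formAction, Derivation.add_apply, map_add]
    ring
  smul_mem' := by
    rintro c D ⟨hD, hD'⟩
    refine ⟨(W F p n₁ n₂).smul_mem c hD, ?_⟩
    rw [← smul_zero c, ← hD']
    simp only [formAction, Derivation.smul_apply, Derivation.map_smul, mul_smul_comm, smul_add]
  lie_mem' := by
    rintro D E ⟨hD, hD'⟩ ⟨hE, hE'⟩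
    refine ⟨(W F p n₁ n₂).lie_mem hD hE, ?_⟩
    rw [formAction_lie F p n₁ n₂ hD hE, hD', hE']
    simp [formAction]

/-- The Hamiltonian algebra `H(2 : n; ω₂)`: the second derived algebra of `H̃(2 : n; ω₂)`. -/
noncomputable abbrev H : LieIdeal F (HTilde F p n₁ n₂) :=
  LieAlgebra.derivedSeries F (HTilde F p n₁ n₂) 2

/-- The derivation `(1 + e) (f_y ∂/∂x - f_x ∂/∂y)` of `F[x, y; n₁, n₂]`, through which `f` is regarded
as an element of `H̃(2 : n; ω₂)`. -/
noncomputable def ham (f : DP F p n₁ n₂) : Derivation F (DP F p n₁ n₂) (DP F p n₁ n₂) :=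
  ((1 + topMon F p n₁ n₂) * dy F p n₁ n₂ f) • dx F p n₁ n₂ -
    ((1 + topMon F p n₁ n₂) * dx F p n₁ n₂ f) • dy F p n₁ n₂

end Derivations

section Cohomology

variable (R L M : Type*) [CommRing R] [LieRing L] [LieAlgebra R L] [AddCommGroup M] [Module R M]
  [LieRingModule L M] [LieModule R L M]

/-- The 2-coboundaries, as a submodule of the 2-cocycles. -/
def twoCoboundary : Submodule R (twoCocycle R L M) :=
  (LinearMap.range (d₁₂ R L M)).submoduleOf (twoCocycle R L M)

/-- The second cohomology group `H²(L, M)`: 2-cocycles modulo 2-coboundaries. -/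
abbrev H2 : Type _ := twoCocycle R L M ⧸ twoCoboundary R L M

end Cohomology

/-- `u ≡ v (mod (p^n₁ - 1, p^n₂ - 1))`, that is, `u` and `v` have the same image in
`ℤ² / ⟨(p^n₁ - 1, p^n₂ - 1)⟩`. -/
def DegCongr (p n₁ n₂ : ℕ) (u v : ℤ × ℤ) : Prop :=
  u - v ∈ AddSubgroup.zmultiples (((p : ℤ) ^ n₁ - 1, (p : ℤ) ^ n₂ - 1) : ℤ × ℤ)

open Classical in
/-- The value of `φ_r` on the pair `x^(i) y^(j)`, `x^(k) y^(l)`. -/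
noncomputable def phiValue (F : Type*) [Field F] (p n₁ n₂ r i j k l : ℕ) : F :=
  if DegCongr p n₁ n₂ ((i : ℤ) + k, (j : ℤ) + l) (0, (p : ℤ) ^ r) then (-1) ^ (i + j) else 0

open Classical in
/-- The value of `ψ_s` on the pair `x^(i) y^(j)`, `x^(k) y^(l)`. -/
noncomputable def psiValue (F : Type*) [Field F] (p n₁ n₂ s i j k l : ℕ) : F :=
  if DegCongr p n₁ n₂ ((i : ℤ) + k, (j : ℤ) + l) ((p : ℤ) ^ s, 0) then (-1) ^ (i + j + 1) else 0

/-- Indices of the monomials `x^(i) y^(j)` of `F[x, y; n₁, n₂]` other than `1`. -/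
abbrev MonIdx (p n₁ n₂ : ℕ) : Type :=
  {a : Fin (p ^ n₁) × Fin (p ^ n₂) // ¬ ((a.1 : ℕ) = 0 ∧ (a.2 : ℕ) = 0)}

/-- The trivial `H(2 : n; ω₂)`-module `F`. -/
abbrev Triv (F : Type*) [Field F] (p n₁ n₂ : ℕ) [Fact p.Prime] [CharP F p] : Type _ :=
  TrivialLieModule F (H F p n₁ n₂) F

end HamiltonianLie

/-!
The Hamiltonian algebra is presented by divided powers: `f ↦ ham f` has kernel the constants,
satisfies `[ham f, ham g] = ham (ham f g)`, and has the second derived algebra of `H̃(2 : n; ω₂)` as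
its image. Indeed the bracket of two derivations that annihilate `ω₂` is `ham` of the contraction of
`ω₂` with both of them (`lie_eq_ham`), and every monomial other than `1` is, modulo constants, up to
sign of the form `ham y f` or `ham x f`. So scalar 2-cocycles of the algebra are alternating forms
`Φ` on divided powers with `1` in the radical and
`Φ (ham f g, h) + Φ (ham g h, f) + Φ (ham h f, g) = 0`, and coboundaries are the forms
`ℓ (ham f g)`.

*Upper bound.* Let `Φ` vanish on all pairs `(y, y^(j))` and `(x, x^(i))`. Every coboundary does so.
On the monomials outside the kernel of `ham y` the form `Φ (y, ·)` can be matched by a coboundary,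
and so can the values `Φ (x, x^(p^n₁ - 1) y^(j))`. After subtracting it, `y` is in the radical, so
that `ham y` is skew for `Φ`; this invariance forces `x` into the radical as well (`x_radical`), and
then skewness of `ham x` and `ham y` gives `Φ = 0` (`eq_zero_of_radical`). Hence the class of `Φ` is
determined by the values on `(y, y^(j))` and `(x, x^(i))`. Two instances of the cocycle identity
give for `h c = Φ (y^(c), y^(m - c))`, `m = j + 1`, the relations `h c = -(m - 1 choose c) h 1` and
`h c = -h (c + 1)`, so that `(m choose k) h 1 = 0` for `0 < k < m`. Therefore `h 1 = 0` unless all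
inner binomial coefficients of `m` are divisible by `p`, that is, unless `m` is a power of `p`
(`y_pow_eq_zero`, `x_pow_eq_zero`). This leaves `n₂ + n₁` values (`IsHamQuotient.obstruction`).

*Lower bound.* The coefficient of `e` in `(1 - e) f` is an integral invariant under all `ham f`, so
each `ham f` is skew for `(g, h) ↦ ∫ g h ω₂`. In characteristic `p` the iterate `(ham f)^(p^r)` is
again a derivation of the bracket, and it is skew since `p` is odd; hence
`(g, h) ↦ ∫ (ham f)^(p^r) g * h ω₂` is a cocycle (`isHamCocycle_powForm`). For `f = x` and `f = y`
these are `φ_r` and `ψ_s` (`powForm_x_mon`, `powForm_y_mon`), and they are dual to the values that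
remain above.
-/

namespace HamiltonianLie

open scoped TensorProduct

open LieModule.Cohomology

set_option linter.unusedSectionVars false

variable {F : Type*} [Field F] {p n₁ n₂ : ℕ} [Fact p.Prime] [CharP F p]

local notation "𝔸" => DP F p n₁ n₂
local notation "𝐦" => mon F (p ^ n₁) (p ^ n₂)
local notation "𝐞" => topMon F p n₁ n₂
local notation "∂x" => dx F p n₁ n₂
local notation "∂y" => dy F p n₁ n₂
local notation "𝐡" => ham F p n₁ n₂

/-! ### The bracket on divided powers -/

variable (p) in
lemma one_lt_pow_of_neZero (n : ℕ) [NeZero n] : 1 < p ^ n :=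
  Nat.one_lt_pow (NeZero.ne n) (Fact.out : p.Prime).one_lt

variable (F) in
lemma two_ne_zero_of_odd (hp : Odd p) : (2 : F) ≠ 0 := by
  intro h
  have h2 := (CharP.cast_eq_zero_iff F p 2).1 (by exact_mod_cast h)
  obtain rfl := (Nat.prime_dvd_prime_iff_eq Fact.out Nat.prime_two).1 h2
  exact absurd hp (by decide)

lemma ham_apply (f g : 𝔸) : 𝐡 f g = (1 + 𝐞) * (∂y f * ∂x g - ∂x f * ∂y g) := by
  simp only [ham, Derivation.sub_apply, Derivation.smul_apply, smul_eq_mul]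
  ring

lemma ham_swap (f g : 𝔸) : 𝐡 f g = -𝐡 g f := by
  rw [ham_apply, ham_apply]
  ring

lemma ham_self (f : 𝔸) : 𝐡 f f = 0 := by
  rw [ham_apply]
  ring

/-- The map `f ↦ ham f` as a linear map. -/
noncomputable def hamLin (F : Type*) [Field F] (p n₁ n₂ : ℕ) [Fact p.Prime] [CharP F p] :
    DP F p n₁ n₂ →ₗ[F] Derivation F (DP F p n₁ n₂) (DP F p n₁ n₂) where
  toFun := ham F p n₁ n₂
  map_add' f g := by
    refine Derivation.ext fun h => ?_
    simp only [ham_apply, Derivation.add_apply, map_add]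
    ring
  map_smul' c f := by
    refine Derivation.ext fun h => ?_
    simp only [ham_apply, Derivation.smul_apply, Derivation.map_smul, RingHom.id_apply,
      smul_mul_assoc, ← smul_sub, mul_smul_comm]

@[simp]
lemma hamLin_apply (f : 𝔸) : hamLin F p n₁ n₂ f = 𝐡 f := rfl

lemma ham_add (f g : 𝔸) : 𝐡 (f + g) = 𝐡 f + 𝐡 g := (hamLin F p n₁ n₂).map_add f g

lemma ham_smul (c : F) (f : 𝔸) : 𝐡 (c • f) = c • 𝐡 f := (hamLin F p n₁ n₂).map_smul c f

lemma ham_neg (f : 𝔸) : 𝐡 (-f) = -𝐡 f := (hamLin F p n₁ n₂).map_neg f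

lemma ham_one : 𝐡 1 = 0 := by
  refine Derivation.ext fun h => ?_
  rw [ham_apply]
  simp

lemma ham_apply_one (f : 𝔸) : 𝐡 f 1 = 0 := Derivation.map_one_eq_zero _

/-- The coefficient of a monomial, as a linear functional. -/
def coeffLin (F : Type*) [Field F] {q₁ q₂ : ℕ} (u : Fin q₁ × Fin q₂) : TruncDP F q₁ q₂ →ₗ[F] F where
  toFun f := f u
  map_add' _ _ := rfl
  map_smul' _ _ := rfl

lemma coeffLin_mon {q₁ q₂ : ℕ} (u : Fin q₁ × Fin q₂) (i j : ℕ) :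
    coeffLin F u (mon F q₁ q₂ i j) = if (u.1 : ℕ) = i ∧ (u.2 : ℕ) = j then 1 else 0 := rfl

lemma coeffLin_ext {q₁ q₂ : ℕ} {f g : TruncDP F q₁ q₂} (h : ∀ u, coeffLin F u f = coeffLin F u g) :
    f = g :=
  funext h

lemma coeffLin_dx (f : 𝔸) {i : ℕ} (hi : i < p ^ n₁) (j : Fin (p ^ n₂)) :
    coeffLin F (⟨i, hi⟩, j) (∂x f) =
      if h : i + 1 < p ^ n₁ then coeffLin F (⟨i + 1, h⟩, j) f else 0 := by
  induction f using mon_induction with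
  | h_zero => simp
  | h_add f g hf hg => rw [map_add, map_add, hf, hg]; split_ifs <;> simp
  | h_smul c f hf => rw [Derivation.map_smul, map_smul, hf]; split_ifs <;> simp
  | h_mon a b ha hb =>
    rw [dx_mon F p n₁ n₂ ha]
    by_cases h0 : a = 0
    · rw [if_pos h0, map_zero]
      split_ifs
      · rw [coeffLin_mon, if_neg (by simp only; omega)]
      · rfl
    rw [if_neg h0, coeffLin_mon]
    split_ifs with h1 h2 h2
    · rw [coeffLin_mon, if_pos (by simp only at h1 ⊢; omega)]
    · simp only at h1
      omega
    · rw [coeffLin_mon, if_neg (by simp only at h1 ⊢; omega)]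
    · rfl

lemma coeffLin_dy (f : 𝔸) (i : Fin (p ^ n₁)) {j : ℕ} (hj : j < p ^ n₂) :
    coeffLin F (i, ⟨j, hj⟩) (∂y f) =
      if h : j + 1 < p ^ n₂ then coeffLin F (i, ⟨j + 1, h⟩) f else 0 := by
  induction f using mon_induction with
  | h_zero => simp
  | h_add f g hf hg => rw [map_add, map_add, hf, hg]; split_ifs <;> simp
  | h_smul c f hf => rw [Derivation.map_smul, map_smul, hf]; split_ifs <;> simp
  | h_mon a b ha hb =>
    rw [dy_mon F p n₁ n₂ hb]
    by_cases h0 : b = 0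
    · rw [if_pos h0, map_zero]
      split_ifs
      · rw [coeffLin_mon, if_neg (by simp only; omega)]
      · rfl
    rw [if_neg h0, coeffLin_mon]
    split_ifs with h1 h2 h2
    · rw [coeffLin_mon, if_pos (by simp only at h1 ⊢; omega)]
    · simp only at h1
      omega
    · rw [coeffLin_mon, if_neg (by simp only at h1 ⊢; omega)]
    · rfl

lemma top_mul_mon {i j : ℕ} (h : i ≠ 0 ∨ j ≠ 0) : 𝐞 * 𝐦 i j = 0 := by
  have hp : 0 < p := (Fact.out : p.Prime).pos
  have h1 : 0 < p ^ n₁ := by positivity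
  have h2 : 0 < p ^ n₂ := by positivity
  rw [topMon, mon_mul_mon, mon_eq_zero (by omega), smul_zero]

lemma top_add_one_mul_mon {i j : ℕ} (h : i ≠ 0 ∨ j ≠ 0) : (1 + 𝐞) * 𝐦 i j = 𝐦 i j := by
  rw [add_mul, one_mul, top_mul_mon h, add_zero]

section NeZero

variable [NeZero n₁] [NeZero n₂]

lemma top_mul_top : 𝐞 * 𝐞 = 0 := by
  have h1 := one_lt_pow_of_neZero p n₁
  exact top_mul_mon (by omega)

lemma dx_x : ∂x (𝐦 1 0) = 1 := by
  rw [dx_mon F p n₁ n₂ (one_lt_pow_of_neZero p n₁), if_neg one_ne_zero, one_def]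

lemma dy_x : ∂y (𝐦 1 0) = 0 := by
  have h2 := one_lt_pow_of_neZero p n₂
  rw [dy_mon F p n₁ n₂ (by omega), if_pos rfl]

lemma dx_y : ∂x (𝐦 0 1) = 0 := by
  have h2 := one_lt_pow_of_neZero p n₁
  rw [dx_mon F p n₁ n₂ (by omega), if_pos rfl]

lemma dy_y : ∂y (𝐦 0 1) = 1 := by
  rw [dy_mon F p n₁ n₂ (one_lt_pow_of_neZero p n₂), if_neg one_ne_zero, one_def]

lemma ham_x_apply (f : 𝔸) : 𝐡 (𝐦 1 0) f = -((1 + 𝐞) * ∂y f) := by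
  rw [ham_apply, dx_x, dy_x]
  ring

lemma ham_y_apply (f : 𝔸) : 𝐡 (𝐦 0 1) f = (1 + 𝐞) * ∂x f := by
  rw [ham_apply, dx_y, dy_y]
  ring

lemma ham_apply_x (f : 𝔸) : 𝐡 f (𝐦 1 0) = (1 + 𝐞) * ∂y f := by
  rw [ham_apply, dx_x, dy_x]
  ring

lemma ham_apply_y (f : 𝔸) : 𝐡 f (𝐦 0 1) = -((1 + 𝐞) * ∂x f) := by
  rw [ham_apply, dx_y, dy_y]
  ring

lemma ham_mem_W (f : 𝔸) : 𝐡 f ∈ W F p n₁ n₂ :=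
  ⟨(1 + 𝐞) * ∂y f, -((1 + 𝐞) * ∂x f), by rw [ham, neg_smul, sub_eq_add_neg]⟩

lemma ham_mem_HTilde (f : 𝔸) : 𝐡 f ∈ HTilde F p n₁ n₂ := by
  refine ⟨ham_mem_W f, ?_⟩
  have hx : ∂x (𝐞 * 𝐞) = 0 := by rw [top_mul_top, map_zero]
  have hy : ∂y (𝐞 * 𝐞) = 0 := by rw [top_mul_top, map_zero]
  have hc := dx_dy_comm F p n₁ n₂ f
  simp only [Derivation.leibniz, smul_eq_mul] at hx hy
  simp only [formAction, ham_apply_x, ham_apply_y]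
  simp only [ham_apply, map_sub, map_neg, map_add, Derivation.leibniz, smul_eq_mul,
    Derivation.map_one_eq_zero]
  linear_combination -∂y f * hx + ∂x f * hy + (1 - 𝐞) * (1 + 𝐞) * hc

/-- The bracket of two derivations annihilating `ω₂` is Hamiltonian: its Hamiltonian is the
contraction of `ω₂` with the two derivations. -/
lemma lie_eq_ham {D E : Derivation F 𝔸 𝔸} (hD : D ∈ HTilde F p n₁ n₂)
    (hE : E ∈ HTilde F p n₁ n₂) :
    ⁅D, E⁆ = 𝐡 ((1 - 𝐞) * (D (𝐦 0 1) * E (𝐦 1 0) - D (𝐦 1 0) * E (𝐦 0 1))) := by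
  obtain ⟨hD1, hD2⟩ := hD
  obtain ⟨hE1, hE2⟩ := hE
  have h1 : ∀ h, D h = D (𝐦 1 0) * ∂x h + D (𝐦 0 1) * ∂y h := fun h =>
    congrArg (fun D' => D' h) (eq_of_mem_W F p n₁ n₂ hD1)
  have h2 : ∀ h, E h = E (𝐦 1 0) * ∂x h + E (𝐦 0 1) * ∂y h := fun h =>
    congrArg (fun D' => D' h) (eq_of_mem_W F p n₁ n₂ hE1)
  have he : 𝐞 * 𝐞 = 0 := top_mul_top
  refine Derivation.ext fun h => ?_
  rw [ham_apply, Derivation.commutator_apply]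
  simp only [formAction, h1 (1 - 𝐞), h2 (1 - 𝐞)] at hD2 hE2
  rw [h1 (E h), h2 (D h), h1 h, h2 h]
  generalize D (𝐦 1 0) = u at *
  generalize D (𝐦 0 1) = v at *
  generalize E (𝐦 1 0) = u' at *
  generalize E (𝐦 0 1) = v' at *
  simp only [map_add, map_sub, Derivation.leibniz, smul_eq_mul, dx_dy_comm,
    Derivation.map_one_eq_zero] at hD2 hE2 ⊢
  linear_combination (-(1 + 𝐞) * u' * hD2 + (1 + 𝐞) * u * hE2) * ∂x h +
    (-(1 + 𝐞) * v' * hD2 + (1 + 𝐞) * v * hE2) * ∂y h +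
    he * ((u * ∂x u' + v * ∂y u' - u' * ∂x u - v' * ∂y u) * ∂x h +
      (u * ∂x v' + v * ∂y v' - u' * ∂x v - v' * ∂y v) * ∂y h)

/-- `f ↦ ham f` intertwines the bracket `(f, g) ↦ ham f g` with the commutator. -/
lemma ham_lie (f g : 𝔸) : ⁅𝐡 f, 𝐡 g⁆ = 𝐡 (𝐡 f g) := by
  rw [lie_eq_ham (ham_mem_HTilde f) (ham_mem_HTilde g)]
  congr 1
  rw [ham_apply_x, ham_apply_x, ham_apply_y, ham_apply_y, ham_apply f g]
  linear_combination -(1 + 𝐞) * (∂y f * ∂x g - ∂x f * ∂y g) * top_mul_top (F := F) (p := p)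
    (n₁ := n₁) (n₂ := n₂)

lemma ham_jacobi (f g h : 𝔸) : 𝐡 f (𝐡 g h) = 𝐡 (𝐡 f g) h + 𝐡 g (𝐡 f h) := by
  rw [← ham_lie, Derivation.commutator_apply]
  abel

/-! ### Values of the bracket on monomials -/

/-- `ham y = (1 + e) ∂/∂x` on monomials. -/
lemma ham_y_mon_succ {i j : ℕ} (h : i ≠ 0 ∨ j ≠ 0) (hi : i + 1 < p ^ n₁) :
    𝐡 (𝐦 0 1) (𝐦 (i + 1) j) = 𝐦 i j := by
  rw [ham_y_apply, dx_mon F p n₁ n₂ hi, if_neg (by omega), Nat.add_sub_cancel,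
    top_add_one_mul_mon h]

lemma ham_y_x : 𝐡 (𝐦 0 1) (𝐦 1 0) = 1 + 𝐞 := by
  rw [ham_y_apply, dx_x, mul_one]

lemma ham_y_mon_zero (j : ℕ) : 𝐡 (𝐦 0 1) (𝐦 0 j) = 0 := by
  have h1 := one_lt_pow_of_neZero p n₁
  rw [ham_y_apply, dx_mon F p n₁ n₂ (by omega), if_pos rfl, mul_zero]

lemma ham_y_pow_mon {i j N : ℕ} (hi : i < p ^ n₁) (h : j ≠ 0 ∨ N < i) :
    (𝐡 (𝐦 0 1))^[N] (𝐦 i j) = if N ≤ i then 𝐦 (i - N) j else 0 := by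
  induction N with
  | zero => simp
  | succ N ih =>
    rw [Function.iterate_succ_apply', ih (by omega)]
    by_cases hN : N ≤ i
    · rw [if_pos hN]
      by_cases hN' : N + 1 ≤ i
      · rw [if_pos hN', show i - N = i - (N + 1) + 1 by omega,
          ham_y_mon_succ (by omega) (by omega)]
      · rw [if_neg hN', show i - N = 0 by omega, ham_y_mon_zero]
    · rw [if_neg hN, if_neg (by omega), map_zero]

lemma ham_y_pow_x {i : ℕ} (hi0 : 0 < i) (hi : i < p ^ n₁) :
    (𝐡 (𝐦 0 1))^[i] (𝐦 i 0) = 1 + 𝐞 := by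
  obtain ⟨i, rfl⟩ : ∃ k, i = k + 1 := ⟨i - 1, by omega⟩
  rw [Function.iterate_succ_apply', ham_y_pow_mon hi (by omega), if_pos (by omega),
    Nat.add_sub_cancel_left, ham_y_x]

/-- `ham x = -(1 + e) ∂/∂y` on monomials. -/
lemma ham_x_mon_succ {i j : ℕ} (h : i ≠ 0 ∨ j ≠ 0) (hj : j + 1 < p ^ n₂) :
    𝐡 (𝐦 1 0) (𝐦 i (j + 1)) = -𝐦 i j := by
  rw [ham_x_apply, dy_mon F p n₁ n₂ hj, if_neg (by omega), Nat.add_sub_cancel,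
    top_add_one_mul_mon h]

lemma ham_x_y : 𝐡 (𝐦 1 0) (𝐦 0 1) = -(1 + 𝐞) := by
  rw [ham_x_apply, dy_y, mul_one]

lemma ham_x_mon_zero (i : ℕ) : 𝐡 (𝐦 1 0) (𝐦 i 0) = 0 := by
  have h2 := one_lt_pow_of_neZero p n₂
  rw [ham_x_apply, dy_mon F p n₁ n₂ (by omega), if_pos rfl, mul_zero, neg_zero]

/-! ### The Hamiltonian algebra as a quotient of divided powers -/

/-- The constants are the only elements with zero Hamiltonian derivation. -/
lemma ham_eq_zero_iff (f : 𝔸) : 𝐡 f = 0 ↔ ∃ c : F, f = c • 1 := by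
  constructor
  · intro h
    have he : 𝐞 * 𝐞 = 0 := top_mul_top
    have hx : ∂x f = 0 := by
      have := congrArg (fun D => D (𝐦 0 1)) h
      simp only [ham_apply_y, Derivation.zero_apply] at this
      linear_combination -(1 - 𝐞) * this + he * ∂x f
    have hy : ∂y f = 0 := by
      have := congrArg (fun D => D (𝐦 1 0)) h
      simp only [ham_apply_x, Derivation.zero_apply] at this
      linear_combination (1 - 𝐞) * this + he * ∂y f
    have h1 := one_lt_pow_of_neZero p n₁
    have h2 := one_lt_pow_of_neZero p n₂
    refine ⟨coeffLin F (⟨0, by omega⟩, ⟨0, by omega⟩) f, coeffLin_ext ?_⟩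
    rintro ⟨⟨i, hi⟩, ⟨j, hj⟩⟩
    rw [map_smul, one_def, coeffLin_mon]
    rcases i with _ | i
    · rcases j with _ | j
      · simp
      · have := coeffLin_dy f ⟨0, hi⟩ (j := j) (by omega)
        rw [hy, map_zero, dif_pos hj] at this
        rw [← this]
        simp
    · have := coeffLin_dx f (i := i) (by omega) ⟨j, hj⟩
      rw [hx, map_zero, dif_pos hi] at this
      rw [← this]
      simp
  · rintro ⟨c, rfl⟩
    rw [ham_smul, ham_one, smul_zero]

/-- Every derivation `ham f` lies in the span of brackets of such derivations. -/
lemma range_hamLin_le : LinearMap.range (hamLin F p n₁ n₂) ≤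
    Submodule.span F {D | ∃ f g : 𝔸, D = 𝐡 (𝐡 f g)} := by
  rintro _ ⟨f, rfl⟩
  rw [hamLin_apply]
  have hb : ∀ f g : 𝔸, 𝐡 (𝐡 f g) ∈ Submodule.span F {D | ∃ f g : 𝔸, D = 𝐡 (𝐡 f g)} :=
    fun f g => Submodule.subset_span ⟨f, g, rfl⟩
  have h1 := one_lt_pow_of_neZero p n₁
  have h2 := one_lt_pow_of_neZero p n₂
  induction f using mon_induction with
  | h_zero => rw [← hamLin_apply, map_zero]; exact zero_mem _
  | h_add f g hf hg => rw [ham_add]; exact add_mem hf hg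
  | h_smul c f hf => rw [ham_smul]; exact Submodule.smul_mem _ c hf
  | h_mon i j hi hj =>
    by_cases h0 : i = 0 ∧ j = 0
    · rw [h0.1, h0.2, ← one_def, ham_one]
      exact zero_mem _
    by_cases hi' : i + 1 < p ^ n₁
    · rw [← ham_y_mon_succ (F := F) (n₂ := n₂) (by omega : i ≠ 0 ∨ j ≠ 0) hi']
      exact hb _ _
    by_cases hj' : j + 1 < p ^ n₂
    · rw [← neg_neg (𝐦 i j),
        ← ham_x_mon_succ (F := F) (n₁ := n₁) (by omega : i ≠ 0 ∨ j ≠ 0) hj', ham_neg]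
      exact neg_mem (hb _ _)
    · obtain rfl : i = p ^ n₁ - 1 := by omega
      obtain rfl : j = p ^ n₂ - 1 := by omega
      have := hb (𝐦 0 1) (𝐦 1 0)
      rwa [ham_y_x, ham_add, ham_one, zero_add] at this

/-- `f` regarded as an element of `H̃(2 : n; ω₂)`. -/
noncomputable def hamT (F : Type*) [Field F] (p n₁ n₂ : ℕ) [Fact p.Prime] [CharP F p] [NeZero n₁]
    [NeZero n₂] : DP F p n₁ n₂ →ₗ[F] HTilde F p n₁ n₂ :=
  LinearMap.codRestrict (HTilde F p n₁ n₂).toSubmodule (hamLin F p n₁ n₂) ham_mem_HTilde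

lemma hamT_lie (f g : 𝔸) : ⁅hamT F p n₁ n₂ f, hamT F p n₁ n₂ g⁆ = hamT F p n₁ n₂ (𝐡 f g) :=
  Subtype.ext (ham_lie f g)

lemma hamT_mem_derivedSeries (k : ℕ) (f : 𝔸) :
    hamT F p n₁ n₂ f ∈ LieAlgebra.derivedSeries F (HTilde F p n₁ n₂) k := by
  induction k generalizing f with
  | zero => exact LieSubmodule.mem_top _
  | succ k ih =>
    rw [show LieAlgebra.derivedSeries F (HTilde F p n₁ n₂) (k + 1) =
        ⁅LieAlgebra.derivedSeries F (HTilde F p n₁ n₂) k,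
          LieAlgebra.derivedSeries F (HTilde F p n₁ n₂) k⁆ from
      LieAlgebra.derivedSeriesOfIdeal_succ F (HTilde F p n₁ n₂) ⊤ k]
    have key : LinearMap.range (hamLin F p n₁ n₂) ≤
        ((⁅LieAlgebra.derivedSeries F (HTilde F p n₁ n₂) k,
          LieAlgebra.derivedSeries F (HTilde F p n₁ n₂) k⁆ :
            LieIdeal F (HTilde F p n₁ n₂)).toSubmodule).map
          (HTilde F p n₁ n₂).toSubmodule.subtype := by
      refine range_hamLin_le.trans (Submodule.span_le.2 ?_)
      rintro _ ⟨f, g, rfl⟩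
      refine ⟨hamT F p n₁ n₂ (𝐡 f g), ?_, rfl⟩
      rw [← hamT_lie]
      exact LieSubmodule.lie_mem_lie (ih f) (ih g)
    obtain ⟨D, hD, hD'⟩ := key ⟨f, rfl⟩
    have : hamT F p n₁ n₂ f = D := Subtype.ext hD'.symm
    rw [this]
    exact hD

/-- `f` regarded as an element of `H(2 : n; ω₂)`. -/
noncomputable def hamL (F : Type*) [Field F] (p n₁ n₂ : ℕ) [Fact p.Prime] [CharP F p] [NeZero n₁]
    [NeZero n₂] : DP F p n₁ n₂ →ₗ[F] H F p n₁ n₂ :=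
  LinearMap.codRestrict (H F p n₁ n₂).toSubmodule (hamT F p n₁ n₂) (hamT_mem_derivedSeries 2)

lemma hamL_coe (f : 𝔸) :
    ((hamL F p n₁ n₂ f : HTilde F p n₁ n₂) : Derivation F 𝔸 𝔸) = 𝐡 f := rfl

lemma hamL_lie (f g : 𝔸) : ⁅hamL F p n₁ n₂ f, hamL F p n₁ n₂ g⁆ = hamL F p n₁ n₂ (𝐡 f g) :=
  Subtype.ext (hamT_lie f g)

lemma hamL_eq_zero_iff (f : 𝔸) : hamL F p n₁ n₂ f = 0 ↔ ∃ c : F, f = c • 1 := by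
  rw [← ham_eq_zero_iff, ← hamL_coe]
  simp

lemma hamL_surjective : Function.Surjective (hamL F p n₁ n₂) := by
  -- already the first derived algebra consists of Hamiltonian derivations
  have key : (LieAlgebra.derivedSeries F (HTilde F p n₁ n₂) 2).toSubmodule ≤
      LinearMap.range (hamT F p n₁ n₂) := by
    change (⁅LieAlgebra.derivedSeries F (HTilde F p n₁ n₂) 1,
      LieAlgebra.derivedSeries F (HTilde F p n₁ n₂) 1⁆ :
        LieIdeal F (HTilde F p n₁ n₂)).toSubmodule ≤ _
    rw [LieSubmodule.lieIdeal_oper_eq_linear_span]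
    refine Submodule.span_le.2 ?_
    rintro _ ⟨D, E, rfl⟩
    exact ⟨_, Subtype.ext (lie_eq_ham D.1.2 E.1.2).symm⟩
  rintro ⟨D, hD⟩
  obtain ⟨f, hf⟩ := key hD
  exact ⟨f, Subtype.ext hf⟩

end NeZero

/-! ### Cocycles on divided powers -/

/-- A 2-cocycle of `H(2 : n; ω₂)` with trivial coefficients, pulled back along `f ↦ ham f`: an
alternating form on divided powers that satisfies the cocycle identity for the bracket
`(f, g) ↦ ham f g` and has the constants in its radical. -/
structure IsHamCocycle (Φ : 𝔸 →ₗ[F] 𝔸 →ₗ[F] F) : Prop where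
  alt : ∀ f, Φ f f = 0
  one_left : ∀ f, Φ 1 f = 0
  cyclic : ∀ f g h, Φ (𝐡 f g) h + Φ (𝐡 g h) f + Φ (𝐡 h f) g = 0

namespace IsHamCocycle

lemma skew {Φ : 𝔸 →ₗ[F] 𝔸 →ₗ[F] F} (hΦ : IsHamCocycle Φ) (f g : 𝔸) : Φ f g = -Φ g f := by
  have h := hΦ.alt (f + g)
  simp only [map_add, LinearMap.add_apply, hΦ.alt] at h
  linear_combination h

lemma one_right {Φ : 𝔸 →ₗ[F] 𝔸 →ₗ[F] F} (hΦ : IsHamCocycle Φ) (f : 𝔸) : Φ f 1 = 0 := by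
  rw [hΦ.skew, hΦ.one_left, neg_zero]

/-- If `Φ(f, ·) = 0`, then `ham f` is skew with respect to `Φ`. -/
lemma ham_skew {Φ : 𝔸 →ₗ[F] 𝔸 →ₗ[F] F} (hΦ : IsHamCocycle Φ) {f : 𝔸}
    (hf : ∀ g, Φ f g = 0) (g h : 𝔸) : Φ (𝐡 f g) h = -Φ g (𝐡 f h) := by
  have h1 := hΦ.cyclic f g h
  rw [ham_swap h f, hΦ.skew (𝐡 g h) f, hf, map_neg, LinearMap.neg_apply, hΦ.skew (𝐡 f h) g] at h1
  linear_combination h1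

variable [NeZero n₁] [NeZero n₂]

lemma sub_ham {Φ : 𝔸 →ₗ[F] 𝔸 →ₗ[F] F} (hΦ : IsHamCocycle Φ) {ℓ : 𝔸 →ₗ[F] F}
    {Ψ : 𝔸 →ₗ[F] 𝔸 →ₗ[F] F} (hΨ : ∀ f g, Ψ f g = Φ f g - ℓ (𝐡 f g)) : IsHamCocycle Ψ where
  alt f := by rw [hΨ, hΦ.alt, ham_self, map_zero, sub_zero]
  one_left f := by rw [hΨ, hΦ.one_left, ham_one, Derivation.zero_apply, map_zero, sub_zero]
  cyclic f g h := by
    have h1 := hΦ.cyclic f g h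
    have h2 : 𝐡 (𝐡 f g) h + 𝐡 (𝐡 g h) f + 𝐡 (𝐡 h f) g = 0 := by
      rw [ham_swap (𝐡 g h) f, ham_jacobi, ham_swap h f, ham_neg, Derivation.neg_apply,
        ham_swap (𝐡 f h) g]
      abel
    have h3 := congrArg ℓ h2
    simp only [map_add, map_zero] at h3
    rw [hΨ, hΨ, hΨ]
    linear_combination h1 - h3

lemma top_left_eq {Φ : 𝔸 →ₗ[F] 𝔸 →ₗ[F] F} (hΦ : IsHamCocycle Φ) (f : 𝔸) : Φ (1 + 𝐞) f = Φ 𝐞 f := by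
  rw [map_add, LinearMap.add_apply, hΦ.one_left, zero_add]

/-- A cocycle with `x` and `y` in its radical vanishes: `ham x` and `ham y` act skewly, and every
monomial is obtained from `e` by applying them. -/
lemma eq_zero_of_radical {Φ : 𝔸 →ₗ[F] 𝔸 →ₗ[F] F} (hΦ : IsHamCocycle Φ)
    (hy : ∀ f, Φ (𝐦 0 1) f = 0)
    (hx : ∀ f, Φ (𝐦 1 0) f = 0) : Φ = 0 := by
  have h1 := one_lt_pow_of_neZero p n₁
  have h2 := one_lt_pow_of_neZero p n₂
  have key : ∀ k i j, i < p ^ n₁ → j < p ^ n₂ → p ^ n₁ - 1 - i + (p ^ n₂ - 1 - j) = k →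
      ∀ g, Φ (𝐦 i j) g = 0 := by
    intro k
    induction k with
    | zero =>
      intro i j hi hj hk g
      obtain rfl : i = p ^ n₁ - 1 := by omega
      obtain rfl : j = p ^ n₂ - 1 := by omega
      change Φ 𝐞 g = 0
      rw [← hΦ.top_left_eq, ← ham_y_x, hΦ.ham_skew hy, hx, neg_zero]
    | succ k ih =>
      intro i j hi hj hk g
      by_cases h0 : i = 0 ∧ j = 0
      · rw [h0.1, h0.2, ← one_def, hΦ.one_left]
      by_cases hi' : i + 1 < p ^ n₁
      · rw [← ham_y_mon_succ (by omega) hi', hΦ.ham_skew hy, ih _ _ hi' hj (by omega), neg_zero]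
      · have hj' : j + 1 < p ^ n₂ := by omega
        rw [← neg_neg (𝐦 i j), ← ham_x_mon_succ (by omega) hj', map_neg, LinearMap.neg_apply,
          hΦ.ham_skew hx, ih _ _ hi hj' (by omega), neg_zero, neg_zero]
  exact mon_ext fun i j hi hj => LinearMap.ext fun g => key _ i j hi hj rfl g

lemma ham_pow_skew {Φ : 𝔸 →ₗ[F] 𝔸 →ₗ[F] F} (hΦ : IsHamCocycle Φ) {f : 𝔸}
    (hf : ∀ g, Φ f g = 0) (n : ℕ) (g h : 𝔸) :
    Φ ((𝐡 f)^[n] g) h = (-1) ^ n * Φ g ((𝐡 f)^[n] h) := by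
  induction n generalizing h with
  | zero => simp
  | succ n ih =>
    rw [Function.iterate_succ_apply', hΦ.ham_skew hf, ih, ← Function.iterate_succ_apply, pow_succ]
    ring

/-- If `y` is in the radical, then `x` is in the radical as soon as `Φ(x, ·)` vanishes on the
monomials that are not obtained by applying `ham y`. -/
lemma x_radical (hp : Odd p) {Φ : 𝔸 →ₗ[F] 𝔸 →ₗ[F] F} (hΦ : IsHamCocycle Φ)
    (hy : ∀ f, Φ (𝐦 0 1) f = 0)
    (hx : ∀ i, Φ (𝐦 1 0) (𝐦 i 0) = 0) (hx' : ∀ j, Φ (𝐦 1 0) (𝐦 (p ^ n₁ - 1) j) = 0) (f : 𝔸) :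
    Φ (𝐦 1 0) f = 0 := by
  have h1 := one_lt_pow_of_neZero p n₁
  have h2 := one_lt_pow_of_neZero p n₂
  have hodd : Odd (p ^ n₁) := hp.pow
  obtain ⟨q, hq⟩ := hodd
  have hq0 : 0 < q := by omega
  suffices H : Φ (𝐦 1 0) = 0 by rw [H, LinearMap.zero_apply]
  refine mon_ext fun i j hi hj => ?_
  rw [LinearMap.zero_apply]
  rcases Nat.eq_zero_or_pos j with rfl | hj0
  · exact hx i
  by_cases hi1 : i = p ^ n₁ - 1
  · rw [hi1]; exact hx' j
  have e1 : Φ (𝐦 1 0) (𝐦 i j) = -Φ 𝐞 (𝐦 (i + 1) j) := by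
    rw [← hΦ.top_left_eq, ← ham_y_x, hΦ.ham_skew hy, ham_y_mon_succ (by omega) (by omega), neg_neg]
  by_cases hi2 : i + 2 < p ^ n₁
  · rw [e1, ← hΦ.top_left_eq, ← ham_y_pow_x (i := i + 2) (by omega) hi2, hΦ.ham_pow_skew hy,
      ham_y_pow_mon (by omega) (by omega), if_neg (by omega), map_zero, mul_zero, neg_zero]
  obtain rfl : i = p ^ n₁ - 2 := by omega
  rw [show p ^ n₁ - 2 + 1 = p ^ n₁ - 1 by omega] at e1
  by_cases hj1 : j = p ^ n₂ - 1
  · rw [e1, hj1]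
    exact neg_eq_zero.2 (hΦ.alt _)
  -- The invariance under `ham y` and the cocycle identity for `x`, `x^(q-1)`, `y^(j+1)`, where
  -- `q = p^n₁`, express the value through `Φ (x^(q-1), y^(j))` with opposite signs.
  have e2 : Φ (𝐦 1 0) (𝐦 (p ^ n₁ - 2) j) = -Φ (𝐦 (p ^ n₁ - 1) 0) (𝐦 0 j) := by
    have h := ham_y_pow_x (F := F) (p := p) (n₁ := n₁) (n₂ := n₂) (i := p ^ n₁ - 1)
      (by omega) (by omega)
    rw [e1, ← hΦ.top_left_eq, ← h, hΦ.ham_pow_skew hy, ham_y_pow_mon (by omega) (by omega),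
      if_pos le_rfl, Nat.sub_self, show p ^ n₁ - 1 = 2 * q by omega, pow_mul]
    simp
  have e3 : Φ (𝐦 1 0) (𝐦 (p ^ n₁ - 2) j) = Φ (𝐦 (p ^ n₁ - 1) 0) (𝐦 0 j) := by
    have h := hΦ.cyclic (𝐦 1 0) (𝐦 (p ^ n₁ - 1) 0) (𝐦 0 (j + 1))
    have h3 : 𝐡 (𝐦 (p ^ n₁ - 1) 0) (𝐦 0 (j + 1)) = -𝐦 (p ^ n₁ - 2) j := by
      rw [ham_apply, dx_mon F p n₁ n₂ (by omega), dx_mon F p n₁ n₂ (by omega),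
        dy_mon F p n₁ n₂ (by omega), dy_mon F p n₁ n₂ (by omega), if_pos rfl, if_pos rfl,
        if_neg (by omega), if_neg (by omega), mon_mul_mon, Nat.add_sub_cancel,
        show p ^ n₁ - 1 - 1 = p ^ n₁ - 2 by omega]
      simp only [add_zero, zero_add, Nat.choose_zero_right, Nat.choose_self, mul_one, Nat.cast_one,
        one_smul, mul_zero, zero_sub, mul_neg]
      rw [top_add_one_mul_mon (by omega)]
    rw [ham_x_mon_zero, h3, ham_swap (𝐦 0 (j + 1)), ham_x_mon_succ (by omega) (by omega), neg_neg,
      map_zero, LinearMap.zero_apply, map_neg, LinearMap.neg_apply, hΦ.skew _ (𝐦 1 0),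
      hΦ.skew (𝐦 0 j)] at h
    linear_combination h
  have e4 : 2 * Φ (𝐦 1 0) (𝐦 (p ^ n₁ - 2) j) = 0 := by linear_combination e2 + e3
  exact (mul_eq_zero.1 e4).resolve_left (two_ne_zero_of_odd F hp)

/-- A cocycle is a coboundary if it vanishes on the pairs `(y, y^(j))` and `(x, x^(i))`. -/
lemma exists_eq_ham (hp : Odd p) {Φ : 𝔸 →ₗ[F] 𝔸 →ₗ[F] F} (hΦ : IsHamCocycle Φ)
    (hy : ∀ j, Φ (𝐦 0 1) (𝐦 0 j) = 0)
    (hx : ∀ i, Φ (𝐦 1 0) (𝐦 i 0) = 0) :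
    ∃ ℓ : 𝔸 →ₗ[F] F, ℓ 1 = 0 ∧ ∀ f g, Φ f g = ℓ (𝐡 f g) := by
  have h1 := one_lt_pow_of_neZero p n₁
  have h2 := one_lt_pow_of_neZero p n₂
  -- `ℓ` is chosen so that subtracting its coboundary kills `Φ (y, ·)` and the values
  -- `Φ (x, x^(q-1) y^(j))`, where `q = p^n₁`
  let v : ℕ → ℕ → F := fun i j =>
    if i = 0 ∧ j = 0 then 0
    else if i + 1 < p ^ n₁ then Φ (𝐦 0 1) (𝐦 (i + 1) j)
    else if j + 1 < p ^ n₂ then -Φ (𝐦 1 0) (𝐦 i (j + 1))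
    else Φ (𝐦 0 1) (𝐦 1 0)
  let ℓ : 𝔸 →ₗ[F] F := (monBasis F (p ^ n₁) (p ^ n₂)).constr F fun u => v u.1 u.2
  have hℓ : ∀ i j, i < p ^ n₁ → j < p ^ n₂ → ℓ (𝐦 i j) = v i j := by
    intro i j hi hj
    have := (monBasis F (p ^ n₁) (p ^ n₂)).constr_basis F (fun u => v u.1 u.2)
      ((⟨i, hi⟩, ⟨j, hj⟩) : Fin (p ^ n₁) × Fin (p ^ n₂))
    rwa [monBasis_apply] at this
  have hℓ1 : ℓ 1 = 0 := by
    rw [one_def, hℓ _ _ (by omega) (by omega)]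
    exact if_pos ⟨rfl, rfl⟩
  refine ⟨ℓ, hℓ1, ?_⟩
  let Ψ : 𝔸 →ₗ[F] 𝔸 →ₗ[F] F := Φ - LinearMap.mk₂ F (fun f g => ℓ (𝐡 f g))
    (fun f f' g => by rw [ham_add, Derivation.add_apply, map_add])
    (fun c f g => by rw [ham_smul, Derivation.smul_apply, map_smul])
    (fun f g g' => by rw [map_add, map_add])
    (fun c f g => by rw [Derivation.map_smul, map_smul])
  have hΨ : ∀ f g, Ψ f g = Φ f g - ℓ (𝐡 f g) := fun _ _ => rfl
  have hΨc : IsHamCocycle Ψ := hΦ.sub_ham hΨ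
  have hy' : ∀ f, Ψ (𝐦 0 1) f = 0 := by
    suffices H : Ψ (𝐦 0 1) = 0 by intro f; rw [H, LinearMap.zero_apply]
    refine mon_ext fun i j hi hj => ?_
    rw [LinearMap.zero_apply, hΨ]
    rcases i with _ | i
    · rw [hy, ham_y_mon_zero, map_zero, sub_zero]
    by_cases h0 : i = 0 ∧ j = 0
    · rw [h0.1, h0.2, ham_y_x, map_add, hℓ1, zero_add, topMon, hℓ _ _ (by omega) (by omega)]
      simp only [v]
      rw [if_neg (by omega), if_neg (by omega), if_neg (by omega), zero_add, sub_self]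
    · rw [ham_y_mon_succ (by omega) hi, hℓ _ _ (by omega) hj]
      simp only [v]
      rw [if_neg h0, if_pos hi, sub_self]
  have hx1 : ∀ i, Ψ (𝐦 1 0) (𝐦 i 0) = 0 := by
    intro i
    rw [hΨ, hx, ham_x_mon_zero, map_zero, sub_zero]
  have hx2 : ∀ j, Ψ (𝐦 1 0) (𝐦 (p ^ n₁ - 1) j) = 0 := by
    intro j
    rcases j with _ | j
    · exact hx1 _
    by_cases hj : j + 1 < p ^ n₂
    · rw [hΨ, ham_x_mon_succ (by omega) hj, map_neg, hℓ _ _ (by omega) (by omega)]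
      simp only [v]
      rw [if_neg (by omega), if_neg (by omega), if_pos hj]
      ring
    · rw [mon_eq_zero (i := p ^ n₁ - 1) (j := j + 1) (by omega), map_zero]
  have hΨ0 : Ψ = 0 := hΨc.eq_zero_of_radical hy' (hΨc.x_radical hp hy' hx1 hx2)
  intro f g
  have := hΨ f g
  rw [hΨ0] at this
  simp only [LinearMap.zero_apply] at this
  linear_combination -this

end IsHamCocycle

/-! ### The possible values of a cocycle on powers of one variable -/

/-- If `p` divides all the inner binomial coefficients of `m`, then `m` is a power of `p`. -/
lemma exists_eq_pow_of_dvd_choose {m : ℕ} (hm : 1 < m)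
    (h : ∀ k, 0 < k → k < m → p ∣ m.choose k) : ∃ r, 0 < r ∧ m = p ^ r := by
  have h1 := Choose.eq_pow_multiplicity_of_choose_modEq_zero_nat (p := p) (n := m) (by omega)
    fun i hi => (Nat.modEq_zero_iff_dvd).2 <| by
      rw [Finset.mem_Icc] at hi
      exact h i (by omega) (by omega)
  refine ⟨_, Nat.pos_of_ne_zero fun h0 => ?_, h1⟩
  rw [h0, pow_zero] at h1
  omega

/-- A sequence with the recursion satisfied by the values of a cocycle on pairs of powers of one
variable vanishes unless the total degree `m` is a power of `p`. -/
lemma eq_zero_of_choose_rec {m : ℕ} (hm : 1 < m) (hpm : ∀ r, 0 < r → m ≠ p ^ r) {h : ℕ → F}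
    (h1 : ∀ c, 0 < c → c < m → h c = -((m - 1).choose c : F) * h 1)
    (h2 : ∀ c, 0 < c → c + 1 < m → h c = -h (c + 1)) : h 1 = 0 := by
  by_contra h0
  have key : ∀ k, 0 < k → k < m → ((m.choose k : ℕ) : F) = 0 := by
    intro k hk hkm
    obtain ⟨m, rfl⟩ : ∃ n, m = n + 1 := ⟨m - 1, by omega⟩
    obtain ⟨k, rfl⟩ : ∃ n, k = n + 1 := ⟨k - 1, by omega⟩
    refine (mul_eq_zero.1 (?_ : _ * h 1 = 0)).resolve_right h0
    rw [Nat.choose_succ_succ, Nat.cast_add]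
    rcases Nat.eq_zero_or_pos k with rfl | hk0
    · have := h1 1 one_pos hm
      simp only [Nat.add_sub_cancel] at this
      rw [Nat.choose_zero_right, Nat.cast_one]
      linear_combination this
    · have e1 := h1 k hk0 (by omega)
      have e2 := h1 (k + 1) hk hkm
      simp only [Nat.add_sub_cancel] at e1 e2
      linear_combination e1 + e2 - h2 k hk0 hkm
  obtain ⟨r, hr, hmr⟩ := exists_eq_pow_of_dvd_choose (p := p) hm fun k hk hkm =>
    (CharP.cast_eq_zero_iff F p _).1 (key k hk hkm)
  exact hpm r hr hmr

namespace IsHamCocycle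

variable [NeZero n₁] [NeZero n₂]

lemma y_pow_eq_zero {Φ : 𝔸 →ₗ[F] 𝔸 →ₗ[F] F} (hΦ : IsHamCocycle Φ) {j : ℕ}
    (hj : ∀ r, 0 < r → r ≤ n₂ → j + 1 ≠ p ^ r) : Φ (𝐦 0 1) (𝐦 0 j) = 0 := by
  have hp1 : 1 < p := (Fact.out : p.Prime).one_lt
  have q1 := one_lt_pow_of_neZero p n₁
  have q2 := one_lt_pow_of_neZero p n₂
  rcases Nat.eq_zero_or_pos j with rfl | hj0
  · rw [← one_def, hΦ.one_right]
  by_cases hjn : p ^ n₂ ≤ j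
  · rw [mon_eq_zero (i := 0) (j := j) (Or.inr hjn), map_zero]
  refine eq_zero_of_choose_rec (p := p) (m := j + 1) (h := fun c => Φ (𝐦 0 c) (𝐦 0 (j + 1 - c)))
    (by omega) ?_ ?_ ?_
  · intro r hr hjr
    refine hj r hr ?_ hjr
    exact (Nat.pow_le_pow_iff_right hp1).1 (by omega)
  · intro c hc hcj
    -- the cocycle identity for `x y^(c)`, `y`, `y^(b)`
    obtain ⟨b, rfl⟩ : ∃ b, j = c + b := ⟨j - c, by omega⟩
    have h := hΦ.cyclic (𝐦 1 c) (𝐦 0 1) (𝐦 0 (b + 1))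
    have e1 : 𝐡 (𝐦 1 c) (𝐦 0 1) = -𝐦 0 c := by
      rw [ham_apply_y, dx_mon F p n₁ n₂ q1, if_neg one_ne_zero, top_add_one_mul_mon (by omega)]
    have e3 : 𝐡 (𝐦 0 (b + 1)) (𝐦 1 c) = ((c + b).choose c : F) • 𝐦 0 (c + b) := by
      rw [ham_apply, dx_mon F p n₁ n₂ q1, dx_mon F p n₁ n₂ (by omega), dy_mon F p n₁ n₂ (by omega),
        if_pos rfl, if_neg one_ne_zero, if_neg (by omega), zero_mul, sub_zero, mon_mul_mon,
        mul_smul_comm, top_add_one_mul_mon (by omega), Nat.add_sub_cancel, Nat.sub_self,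
        add_comm b c]
      simp [Nat.choose_symm_add (a := c) (b := b)]
    rw [e1, e3, ham_y_mon_zero] at h
    simp only [map_neg, map_zero, map_smul, LinearMap.neg_apply, LinearMap.zero_apply,
      LinearMap.smul_apply, smul_eq_mul] at h
    rw [hΦ.skew (𝐦 0 (c + b)) (𝐦 0 1)] at h
    simp only [Nat.add_sub_cancel, show c + b + 1 - c = b + 1 by omega]
    linear_combination -h
  · intro c hc hcj
    -- the cocycle identity for `x`, `y^(c+1)`, `y^(b+1)`
    obtain ⟨b, rfl⟩ : ∃ b, j = c + b + 1 := ⟨j - c - 1, by omega⟩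
    have h := hΦ.cyclic (𝐦 1 0) (𝐦 0 (c + 1)) (𝐦 0 (b + 2))
    have e2 : 𝐡 (𝐦 0 (c + 1)) (𝐦 0 (b + 2)) = 0 := by
      rw [ham_apply, dx_mon F p n₁ n₂ (by omega), dx_mon F p n₁ n₂ (by omega), if_pos rfl]
      simp
    rw [e2, ham_x_mon_succ (by omega) (by omega), ham_swap _ (𝐦 1 0),
      ham_x_mon_succ (by omega) (by omega), hΦ.skew (- -_)] at h
    simp only [map_neg, map_zero, LinearMap.neg_apply, LinearMap.zero_apply, neg_neg] at h
    simp only [show c + b + 1 + 1 - c = b + 2 by omega,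
      show c + b + 1 + 1 - (c + 1) = b + 1 by omega]
    linear_combination -h

lemma x_pow_eq_zero {Φ : 𝔸 →ₗ[F] 𝔸 →ₗ[F] F} (hΦ : IsHamCocycle Φ) {i : ℕ}
    (hi : ∀ s, 0 < s → s ≤ n₁ → i + 1 ≠ p ^ s) : Φ (𝐦 1 0) (𝐦 i 0) = 0 := by
  have hp1 : 1 < p := (Fact.out : p.Prime).one_lt
  have q1 := one_lt_pow_of_neZero p n₁
  have q2 := one_lt_pow_of_neZero p n₂
  rcases Nat.eq_zero_or_pos i with rfl | hi0
  · rw [← one_def, hΦ.one_right]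
  by_cases hin : p ^ n₁ ≤ i
  · rw [mon_eq_zero (i := i) (j := 0) (Or.inl hin), map_zero]
  refine eq_zero_of_choose_rec (p := p) (m := i + 1) (h := fun c => Φ (𝐦 c 0) (𝐦 (i + 1 - c) 0))
    (by omega) ?_ ?_ ?_
  · intro s hs his
    refine hi s hs ?_ his
    exact (Nat.pow_le_pow_iff_right hp1).1 (by omega)
  · intro c hc hci
    -- the cocycle identity for `x^(c) y`, `x`, `x^(b)`
    obtain ⟨b, rfl⟩ : ∃ b, i = c + b := ⟨i - c, by omega⟩
    have h := hΦ.cyclic (𝐦 c 1) (𝐦 1 0) (𝐦 (b + 1) 0)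
    have e1 : 𝐡 (𝐦 c 1) (𝐦 1 0) = 𝐦 c 0 := by
      rw [ham_apply_x, dy_mon F p n₁ n₂ q2, if_neg one_ne_zero, top_add_one_mul_mon (by omega)]
    have e3 : 𝐡 (𝐦 (b + 1) 0) (𝐦 c 1) = -(((c + b).choose c : F) • 𝐦 (c + b) 0) := by
      rw [ham_apply, dy_mon F p n₁ n₂ q2, dy_mon F p n₁ n₂ (by omega), dx_mon F p n₁ n₂ (by omega),
        dx_mon F p n₁ n₂ (by omega), if_pos rfl, zero_mul, zero_sub, if_neg (Nat.succ_ne_zero b),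
        if_neg one_ne_zero, mon_mul_mon,
        mul_neg, mul_smul_comm, top_add_one_mul_mon (by omega), Nat.add_sub_cancel, Nat.sub_self,
        add_comm b c]
      simp [Nat.choose_symm_add (a := c) (b := b)]
    rw [e1, e3, ham_x_mon_zero] at h
    simp only [map_neg, map_zero, map_smul, LinearMap.neg_apply, LinearMap.zero_apply,
      LinearMap.smul_apply, smul_eq_mul] at h
    rw [hΦ.skew (𝐦 (c + b) 0) (𝐦 1 0)] at h
    simp only [Nat.add_sub_cancel, show c + b + 1 - c = b + 1 by omega]
    linear_combination h
  · intro c hc hci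
    -- the cocycle identity for `y`, `x^(c+1)`, `x^(b+1)`
    obtain ⟨b, rfl⟩ : ∃ b, i = c + b + 1 := ⟨i - c - 1, by omega⟩
    have h := hΦ.cyclic (𝐦 0 1) (𝐦 (c + 1) 0) (𝐦 (b + 2) 0)
    have e2 : 𝐡 (𝐦 (c + 1) 0) (𝐦 (b + 2) 0) = 0 := by
      rw [ham_apply, dy_mon F p n₁ n₂ (by omega), dy_mon F p n₁ n₂ (by omega), if_pos rfl]
      simp
    rw [e2, ham_y_mon_succ (by omega) (by omega), ham_swap _ (𝐦 0 1),
      ham_y_mon_succ (by omega) (by omega), hΦ.skew (-_)] at h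
    simp only [map_neg, map_zero, LinearMap.zero_apply, neg_neg] at h
    simp only [show c + b + 1 + 1 - c = b + 2 by omega,
      show c + b + 1 + 1 - (c + 1) = b + 1 by omega]
    linear_combination h

end IsHamCocycle

/-! ### The cocycles given by powers of `ham x` and `ham y` -/

/-- A `p`-power-th iterate of a derivation of a bilinear product is a derivation. -/
lemma iterate_pow_leibniz {M : Type*} [AddCommGroup M] [Module F M] (D : Module.End F M)
    (μ : M →ₗ[F] M →ₗ[F] M) (h : ∀ a b, D (μ a b) = μ (D a) b + μ a (D b)) (r : ℕ) (a b : M) :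
    (D ^ p ^ r) (μ a b) = μ ((D ^ p ^ r) a) b + μ a ((D ^ p ^ r) b) := by
  -- `D ∘ μ = μ ∘ (D ⊗ 1 + 1 ⊗ D)`, and the two summands commute
  have hc : Commute (D.rTensor M) (D.lTensor M) := by
    change _ ∘ₗ _ = _ ∘ₗ _
    rw [LinearMap.rTensor_comp_lTensor, LinearMap.lTensor_comp_rTensor]
  have hD : D ∘ₗ TensorProduct.lift μ =
      TensorProduct.lift μ ∘ₗ (D.rTensor M + D.lTensor M) :=
    TensorProduct.ext' fun x y => by simp [h]
  have hpow := congrArg (fun g => g (a ⊗ₜ[F] b))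
    (Module.End.commute_pow_left_of_commute hD (p ^ r))
  obtain ⟨R, hR⟩ := hc.exists_add_pow_prime_pow_eq (Fact.out : p.Prime) r
  have hp0 : ((p : Module.End F (M ⊗[F] M)) * D.rTensor M * D.lTensor M * R) (a ⊗ₜ[F] b) = 0 := by
    rw [mul_assoc, mul_assoc, Module.End.mul_apply, Module.End.natCast_apply,
      ← Nat.cast_smul_eq_nsmul F, CharP.cast_eq_zero, zero_smul]
  simp only [LinearMap.comp_apply, hR, LinearMap.add_apply, hp0, LinearMap.rTensor_pow,
    LinearMap.lTensor_pow, LinearMap.rTensor_tmul, LinearMap.lTensor_tmul, map_add,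
    TensorProduct.lift.tmul, add_zero] at hpow
  exact hpow

section NeZero
variable [NeZero n₁] [NeZero n₂]

/-- Integration against `ω₂`: the coefficient of `e` in `(1 - e) f`. -/
noncomputable def integral (F : Type*) [Field F] (p n₁ n₂ : ℕ) [Fact p.Prime] :
    DP F p n₁ n₂ →ₗ[F] F :=
  haveI h1 : 0 < p ^ n₁ := Nat.pow_pos (Fact.out : p.Prime).pos
  haveI h2 : 0 < p ^ n₂ := Nat.pow_pos (Fact.out : p.Prime).pos
  coeffLin F (⟨p ^ n₁ - 1, by omega⟩, ⟨p ^ n₂ - 1, by omega⟩) - coeffLin F (⟨0, h1⟩, ⟨0, h2⟩)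

lemma integral_mon (i j : ℕ) : integral F p n₁ n₂ (𝐦 i j) =
    (if i = p ^ n₁ - 1 ∧ j = p ^ n₂ - 1 then 1 else 0) - (if i = 0 ∧ j = 0 then 1 else 0) := by
  simp only [integral, LinearMap.sub_apply, coeffLin_mon]
  simp only [eq_comm]

/-- Multiplication by `1 + e`, the inverse of `1 - e`, turns the integral against `ω₂` into the
coefficient of `e`. -/
lemma integral_top_mul (f : 𝔸) : integral F p n₁ n₂ ((1 + 𝐞) * f) =
    coeffLin F (⟨p ^ n₁ - 1, Nat.sub_one_lt (by have := one_lt_pow_of_neZero p n₁; omega)⟩,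
      ⟨p ^ n₂ - 1, Nat.sub_one_lt (by have := one_lt_pow_of_neZero p n₂; omega)⟩) f := by
  have h1 := one_lt_pow_of_neZero p n₁
  have h2 := one_lt_pow_of_neZero p n₂
  induction f using mon_induction with
  | h_zero => simp
  | h_add f g hf hg => rw [mul_add, map_add, map_add, hf, hg]
  | h_smul c f hf => rw [mul_smul_comm, map_smul, map_smul, hf]
  | h_mon i j hi hj =>
    by_cases h0 : i = 0 ∧ j = 0
    · rw [h0.1, h0.2, ← one_def, mul_one, map_add, one_def, topMon, integral_mon, integral_mon,
        coeffLin_mon, if_neg (by omega), if_pos (by omega), if_pos (by omega), if_neg (by omega)]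
      ring
    · rw [top_add_one_mul_mon (by omega), integral_mon, coeffLin_mon, if_neg h0, sub_zero]
      simp only [eq_comm]

/-- The integral is invariant under Hamiltonian derivations: `ham f g` is `1 + e` times the
divergence of `(-f g_y, f g_x)`, and derivatives have no component at `e`. -/
lemma integral_ham (f g : 𝔸) : integral F p n₁ n₂ (𝐡 f g) = 0 := by
  have h1 := one_lt_pow_of_neZero p n₁
  have h2 := one_lt_pow_of_neZero p n₂
  have h3 : ∂y f * ∂x g - ∂x f * ∂y g = ∂y (f * ∂x g) - ∂x (f * ∂y g) := by
    simp only [Derivation.leibniz, smul_eq_mul, dx_dy_comm]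
    ring
  rw [ham_apply, integral_top_mul, h3, map_sub, coeffLin_dx, coeffLin_dy, dif_neg (by omega),
    dif_neg (by omega), sub_zero]

lemma integral_ham_mul (f g h : 𝔸) :
    integral F p n₁ n₂ (𝐡 f g * h) = -integral F p n₁ n₂ (g * 𝐡 f h) := by
  have := integral_ham f (g * h)
  rw [Derivation.leibniz, map_add, smul_eq_mul, smul_eq_mul, mul_comm h] at this
  linear_combination this

/-- The bilinear form `(g, h) ↦ ∫ (ham f)^N g * h ω₂`. -/
noncomputable def powForm (f : 𝔸) (N : ℕ) : 𝔸 →ₗ[F] 𝔸 →ₗ[F] F :=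
  (LinearMap.mul F 𝔸).compr₂ (integral F p n₁ n₂) ∘ₗ
    ((𝐡 f : 𝔸 →ₗ[F] 𝔸) ^ N : Module.End F 𝔸)

lemma powForm_apply (f : 𝔸) (N : ℕ) (g h : 𝔸) :
    powForm f N g h = integral F p n₁ n₂ ((𝐡 f)^[N] g * h) := by
  change integral F p n₁ n₂ (((𝐡 f : 𝔸 →ₗ[F] 𝔸) ^ N : Module.End F 𝔸) g * h) = _
  rw [Module.End.pow_apply]
  rfl

lemma integral_iterate_ham_mul (f : 𝔸) (N : ℕ) (g h : 𝔸) :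
    integral F p n₁ n₂ ((𝐡 f)^[N] g * h) = (-1) ^ N * integral F p n₁ n₂ (g * (𝐡 f)^[N] h) := by
  induction N generalizing h with
  | zero => simp
  | succ N ih =>
    rw [Function.iterate_succ_apply', integral_ham_mul, ih, Function.iterate_succ_apply, pow_succ]
    ring

/-- The `p`-power iterates of `ham f` are derivations, skew for the invariant form
`(g, h) ↦ ∫ g h ω₂`, and therefore define cocycles. -/
lemma isHamCocycle_powForm (hp : Odd p) (f : 𝔸) (r : ℕ) : IsHamCocycle (powForm f (p ^ r)) := by
  have skew : ∀ g h : 𝔸, powForm f (p ^ r) g h = -powForm f (p ^ r) h g := by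
    intro g h
    rw [powForm_apply, powForm_apply, integral_iterate_ham_mul, (hp.pow : Odd (p ^ r)).neg_one_pow,
      mul_comm g]
    ring
  let μ : 𝔸 →ₗ[F] 𝔸 →ₗ[F] 𝔸 := LinearMap.mk₂ F (fun f g => 𝐡 f g)
    (fun f f' g => by rw [ham_add, Derivation.add_apply])
    (fun c f g => by rw [ham_smul, Derivation.smul_apply])
    (fun f g g' => by rw [map_add])
    (fun c f g => by rw [Derivation.map_smul])
  have der : ∀ g h : 𝔸, (𝐡 f)^[p ^ r] (𝐡 g h) =
      𝐡 ((𝐡 f)^[p ^ r] g) h + 𝐡 g ((𝐡 f)^[p ^ r] h) := by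
    intro g h
    have := iterate_pow_leibniz (p := p) (𝐡 f : 𝔸 →ₗ[F] 𝔸) μ (fun a b => ham_jacobi f a b) r g h
    rw [Module.End.pow_apply, Module.End.pow_apply, Module.End.pow_apply] at this
    exact this
  constructor
  · intro g
    have h1 := skew g g
    have h2 : 2 * powForm f (p ^ r) g g = 0 := by linear_combination h1
    exact (mul_eq_zero.1 h2).resolve_left (two_ne_zero_of_odd F hp)
  · intro g
    obtain ⟨k, hk⟩ : ∃ k, p ^ r = k + 1 :=
      ⟨p ^ r - 1, (Nat.sub_add_cancel (Nat.pow_pos (Fact.out : p.Prime).pos)).symm⟩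
    rw [powForm_apply, hk, Function.iterate_succ_apply, ham_apply_one,
      Function.iterate_fixed (map_zero _), zero_mul, map_zero]
  · intro g h k
    have h1 : powForm f (p ^ r) (𝐡 g h) k =
        -powForm f (p ^ r) (𝐡 h k) g - powForm f (p ^ r) (𝐡 k g) h := by
      rw [skew (𝐡 h k), skew (𝐡 k g), powForm_apply, powForm_apply, powForm_apply, der, add_mul,
        map_add]
      rw [ham_swap ((𝐡 f)^[p ^ r] g) h, neg_mul, map_neg, integral_ham_mul, integral_ham_mul,
        ham_swap g k, mul_neg, map_neg]
      ring
    linear_combination h1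

end NeZero

/-! ### Values of the cocycles on monomials -/

lemma cast_choose_pow_sub_one (n : ℕ) {i : ℕ} (hi : i < p ^ n) :
    ((p ^ n - 1).choose i : F) = (-1) ^ i := by
  induction i with
  | zero => simp
  | succ i ih =>
    have h1 : (((p ^ n).choose (i + 1) : ℕ) : F) = 0 :=
      (CharP.cast_eq_zero_iff F p _).2 ((Fact.out : p.Prime).dvd_choose_pow (by omega) (by omega))
    rw [show p ^ n = p ^ n - 1 + 1 by omega, Nat.choose_succ_succ, Nat.cast_add,
      ih (by omega)] at h1
    rw [pow_succ]
    linear_combination h1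

section NeZero

variable [NeZero n₁] [NeZero n₂]

lemma integral_mon_mul_mon {i j k l : ℕ} (h0 : i ≠ 0 ∨ j ≠ 0) :
    integral F p n₁ n₂ (𝐦 i j * 𝐦 k l) =
      if i + k = p ^ n₁ - 1 ∧ j + l = p ^ n₂ - 1 then (-1) ^ (i + j) else 0 := by
  have q1 := one_lt_pow_of_neZero p n₁
  have q2 := one_lt_pow_of_neZero p n₂
  rw [mon_mul_mon, map_smul, integral_mon, if_neg (by omega : ¬(i + k = 0 ∧ j + l = 0)), sub_zero]
  split_ifs with h
  · rw [h.1, h.2, Nat.cast_mul, cast_choose_pow_sub_one n₁ (by omega),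
      cast_choose_pow_sub_one n₂ (by omega), pow_add, smul_eq_mul, mul_one]
  · rw [smul_zero]

lemma integral_top_mul_mon {k l : ℕ} : integral F p n₁ n₂ ((1 + 𝐞) * 𝐦 k l) =
    if k = p ^ n₁ - 1 ∧ l = p ^ n₂ - 1 then 1 else 0 := by
  rw [integral_top_mul, coeffLin_mon]
  simp only [eq_comm]

lemma degCongr_iff {i j k l N : ℕ} (hi : i < p ^ n₁) (hj : j < p ^ n₂) (hk : k < p ^ n₁)
    (hl : l < p ^ n₂) (hN : 0 < N) :
    DegCongr p n₁ n₂ ((i : ℤ) + k, (j : ℤ) + l) (0, (N : ℤ)) ↔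
      (i + k = 0 ∧ j + l = N) ∨ (i + k = p ^ n₁ - 1 ∧ j + l = p ^ n₂ - 1 + N) := by
  have q1 := one_lt_pow_of_neZero p n₁
  have q2 := one_lt_pow_of_neZero p n₂
  rw [DegCongr, AddSubgroup.mem_zmultiples_iff]
  simp only [← Nat.cast_pow, Prod.ext_iff, Prod.smul_fst, Prod.smul_snd, Prod.fst_sub,
    Prod.snd_sub, smul_eq_mul]
  generalize p ^ n₁ = Q₁ at *
  generalize p ^ n₂ = Q₂ at *
  constructor
  · rintro ⟨t, ht1, ht2⟩
    have t0 : 0 ≤ t := by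
      by_contra hneg
      nlinarith
    have t2 : t < 2 := by
      by_contra hge
      nlinarith
    interval_cases t <;> omega
  · rintro (⟨h1, h2⟩ | ⟨h1, h2⟩)
    · exact ⟨0, by omega, by omega⟩
    · exact ⟨1, by omega, by omega⟩

lemma degCongr_swap (a b N : ℤ) :
    DegCongr p n₁ n₂ (a, b) (N, 0) ↔ DegCongr p n₂ n₁ (b, a) (0, N) := by
  simp only [DegCongr, AddSubgroup.mem_zmultiples_iff, Prod.ext_iff, Prod.smul_fst, Prod.smul_snd,
    Prod.fst_sub, Prod.snd_sub]
  exact exists_congr fun t => and_comm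

lemma iterate_ham_smul (f : 𝔸) (N : ℕ) (c : F) (g : 𝔸) :
    (𝐡 f)^[N] (c • g) = c • (𝐡 f)^[N] g := by
  induction N with
  | zero => rfl
  | succ N ih =>
    rw [Function.iterate_succ_apply', Function.iterate_succ_apply', ih, Derivation.map_smul]

lemma ham_x_pow_mon {i j N : ℕ} (hj : j < p ^ n₂) (h : i ≠ 0 ∨ N < j) :
    (𝐡 (𝐦 1 0))^[N] (𝐦 i j) = if N ≤ j then (-1 : F) ^ N • 𝐦 i (j - N) else 0 := by
  induction N with
  | zero => simp
  | succ N ih =>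
    rw [Function.iterate_succ_apply', ih (by omega)]
    by_cases hN : N ≤ j
    · rw [if_pos hN, Derivation.map_smul]
      by_cases hN' : N + 1 ≤ j
      · rw [if_pos hN', show j - N = j - (N + 1) + 1 by omega,
          ham_x_mon_succ (by omega) (by omega), pow_succ, mul_neg_one, neg_smul, smul_neg]
      · rw [if_neg hN', show j - N = 0 by omega, ham_x_mon_zero, smul_zero]
    · rw [if_neg hN, if_neg (by omega), map_zero]

lemma ham_x_pow_y {j : ℕ} (hj0 : 0 < j) (hj : j < p ^ n₂) :
    (𝐡 (𝐦 1 0))^[j] (𝐦 0 j) = (-1 : F) ^ j • (1 + 𝐞) := by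
  obtain ⟨j, rfl⟩ : ∃ k, j = k + 1 := ⟨j - 1, by omega⟩
  rw [Function.iterate_succ_apply', ham_x_pow_mon hj (by omega), if_pos (by omega),
    Derivation.map_smul, Nat.add_sub_cancel_left, ham_x_y, pow_succ, mul_neg_one, neg_smul,
    smul_neg]

lemma ham_x_pow_y_add {j c : ℕ} (hj0 : 0 < j) (hj : j < p ^ n₂) (hc0 : 0 < c) (hc : c < p ^ n₂) :
    (𝐡 (𝐦 1 0))^[c + j] (𝐦 0 j) = (-1 : F) ^ (c + j) • 𝐦 (p ^ n₁ - 1) (p ^ n₂ - 1 - c) := by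
  have q1 := one_lt_pow_of_neZero p n₁
  obtain ⟨c, rfl⟩ : ∃ k, c = k + 1 := ⟨c - 1, by omega⟩
  have h1 : 𝐡 (𝐦 1 0) (1 + 𝐞) = 𝐡 (𝐦 1 0) (𝐦 (p ^ n₁ - 1) (p ^ n₂ - 1)) := by
    rw [map_add, ham_apply_one, zero_add, topMon]
  rw [Function.iterate_add_apply, ham_x_pow_y hj0 hj, iterate_ham_smul,
    Function.iterate_succ_apply, h1, ← Function.iterate_succ_apply,
    ham_x_pow_mon (by omega) (by omega), if_pos (by omega), smul_smul, ← pow_add, add_comm j]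

/-- The cocycle attached to the `p^r`-th power of `ham x` is `φ_r`. -/
lemma powForm_x_mon (hp : Odd p) {r : ℕ} (hr : r ≤ n₂) {i j k l : ℕ} (hi : i < p ^ n₁)
    (hj : j < p ^ n₂) (hk : k < p ^ n₁) (hl : l < p ^ n₂) (hij : ¬(i = 0 ∧ j = 0))
    (hkl : ¬(k = 0 ∧ l = 0)) :
    powForm (𝐦 1 0) (p ^ r) (𝐦 i j) (𝐦 k l) = phiValue F p n₁ n₂ r i j k l := by
  have q1 := one_lt_pow_of_neZero p n₁
  have q2 := one_lt_pow_of_neZero p n₂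
  have hN0 : 0 < p ^ r := Nat.pow_pos (Fact.out : p.Prime).pos
  have hN : p ^ r ≤ p ^ n₂ := Nat.pow_le_pow_right (Fact.out : p.Prime).pos hr
  have hodd : Odd (p ^ r) := hp.pow
  have hodd1 : Odd (p ^ n₁) := hp.pow
  have hodd2 : Odd (p ^ n₂) := hp.pow
  have hD := degCongr_iff hi hj hk hl hN0
  rw [Nat.cast_pow] at hD
  rw [phiValue, powForm_apply]
  simp only [hD]
  clear hD
  generalize p ^ r = N at *
  by_cases h : i ≠ 0 ∨ N < j
  · rw [ham_x_pow_mon hj h]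
    by_cases hNj : N ≤ j
    · rw [if_pos hNj, smul_mul_assoc, map_smul, integral_mon_mul_mon (by omega), smul_eq_mul,
        mul_ite, mul_zero, ← pow_add]
      refine if_congr (by omega) ?_ rfl
      congr 1
      omega
    · rw [if_neg hNj, zero_mul, map_zero, if_neg (by omega)]
  obtain rfl : i = 0 := by omega
  rcases Nat.lt_or_ge j N with hjN | hjN
  · obtain ⟨c, rfl⟩ : ∃ c, N = c + j := ⟨N - j, by omega⟩
    rw [ham_x_pow_y_add (by omega) hj (by omega) (by omega), smul_mul_assoc, map_smul,
      integral_mon_mul_mon (by omega), smul_eq_mul, mul_ite, mul_zero, ← pow_add]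
    refine if_congr (by omega) ?_ rfl
    obtain ⟨a, ha⟩ := hodd1
    obtain ⟨b, hb⟩ := hodd2
    rw [show c + j + (p ^ n₁ - 1 + (p ^ n₂ - 1 - c)) = 0 + j + 2 * (a + b) by omega,
      pow_add _ (0 + j), pow_mul]
    simp
  · obtain rfl : j = N := by omega
    rw [ham_x_pow_y hN0 hj, smul_mul_assoc, map_smul, integral_top_mul_mon, smul_eq_mul, mul_ite,
      mul_zero, mul_one, zero_add]
    exact if_congr (by omega) (by rw [zero_add]) rfl

lemma ham_y_pow_x_add {i c : ℕ} (hi0 : 0 < i) (hi : i < p ^ n₁) (hc0 : 0 < c) (hc : c < p ^ n₁) :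
    (𝐡 (𝐦 0 1))^[c + i] (𝐦 i 0) = 𝐦 (p ^ n₁ - 1 - c) (p ^ n₂ - 1) := by
  have q2 := one_lt_pow_of_neZero p n₂
  obtain ⟨c, rfl⟩ : ∃ k, c = k + 1 := ⟨c - 1, by omega⟩
  have h1 : 𝐡 (𝐦 0 1) (1 + 𝐞) = 𝐡 (𝐦 0 1) (𝐦 (p ^ n₁ - 1) (p ^ n₂ - 1)) := by
    rw [map_add, ham_apply_one, zero_add, topMon]
  rw [Function.iterate_add_apply, ham_y_pow_x hi0 hi, Function.iterate_succ_apply, h1,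
    ← Function.iterate_succ_apply, ham_y_pow_mon (by omega) (by omega), if_pos (by omega)]

/-- The cocycle attached to the `p^s`-th power of `ham y` is `ψ_s`. -/
lemma powForm_y_mon (hp : Odd p) {s : ℕ} (hs : s ≤ n₁) {i j k l : ℕ} (hi : i < p ^ n₁)
    (hj : j < p ^ n₂) (hk : k < p ^ n₁) (hl : l < p ^ n₂) (hij : ¬(i = 0 ∧ j = 0))
    (hkl : ¬(k = 0 ∧ l = 0)) :
    powForm (𝐦 0 1) (p ^ s) (𝐦 i j) (𝐦 k l) = psiValue F p n₁ n₂ s i j k l := by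
  have q1 := one_lt_pow_of_neZero p n₁
  have q2 := one_lt_pow_of_neZero p n₂
  have hN0 : 0 < p ^ s := Nat.pow_pos (Fact.out : p.Prime).pos
  have hN : p ^ s ≤ p ^ n₁ := Nat.pow_le_pow_right (Fact.out : p.Prime).pos hs
  have hodd : Odd (p ^ s) := hp.pow
  have hodd1 : Odd (p ^ n₁) := hp.pow
  have hodd2 : Odd (p ^ n₂) := hp.pow
  have hD := degCongr_iff hj hi hl hk hN0
  rw [← degCongr_swap, Nat.cast_pow] at hD
  rw [psiValue, powForm_apply]
  simp only [hD]
  clear hD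
  generalize p ^ s = N at *
  obtain ⟨d, hd⟩ := hodd
  by_cases h : j ≠ 0 ∨ N < i
  · rw [ham_y_pow_mon hi h]
    by_cases hNi : N ≤ i
    · rw [if_pos hNi, integral_mon_mul_mon (by omega)]
      refine if_congr (by omega) ?_ rfl
      rw [show i + j + 1 = i - N + j + 2 * (d + 1) by omega, pow_add _ (i - N + j), pow_mul]
      simp
    · rw [if_neg hNi, zero_mul, map_zero, if_neg (by omega)]
  obtain rfl : j = 0 := by omega
  rcases Nat.lt_or_ge i N with hiN | hiN
  · obtain ⟨c, rfl⟩ : ∃ c, N = c + i := ⟨N - i, by omega⟩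
    rw [ham_y_pow_x_add (by omega) hi (by omega) (by omega), integral_mon_mul_mon (by omega)]
    refine if_congr (by omega) ?_ rfl
    obtain ⟨a, ha⟩ := hodd1
    obtain ⟨b, hb⟩ := hodd2
    have e1 : (-1 : F) ^ (p ^ n₁ - 1 - c + (p ^ n₂ - 1)) * (-1) ^ (2 * c) =
        (-1) ^ (i + 0 + 1) * (-1) ^ (2 * (a + b + d - i)) := by
      rw [← pow_add, ← pow_add]
      congr 1
      omega
    simpa [pow_mul] using e1
  · obtain rfl : i = N := by omega
    rw [ham_y_pow_x hN0 hi, integral_top_mul_mon, show i + 0 + 1 = 2 * (d + 1) by omega, pow_mul]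
    refine if_congr (by omega) ?_ rfl
    simp

end NeZero

/-! ### Scalar 2-cocycles of a Lie algebra -/

section ScalarCocycles

variable {K L : Type*} [Field K] [LieRing L] [LieAlgebra K L]

lemma neg_eq_of_alternating {V : Type*} [AddCommGroup V] [Module K V] {β : V →ₗ[K] V →ₗ[K] K}
    (alt : ∀ u, β u u = 0) (u v : V) :
    β u v = -β v u := by
  have h := alt (u + v)
  simp only [map_add, LinearMap.add_apply, alt] at h
  linear_combination h

/-- The 2-cocycle with trivial coefficients given by an alternating form that satisfies the cocycle
identity. -/
noncomputable def cocycleOfForm (β : L →ₗ[K] L →ₗ[K] K) (alt : ∀ u, β u u = 0)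
    (cyc : ∀ u v w, β u ⁅v, w⁆ = β ⁅u, v⁆ w + β v ⁅u, w⁆) :
    twoCocycle K L (TrivialLieModule K L K) :=
  ⟨⟨β.compr₂ (TrivialLieModule.equiv K L K).symm.toLinearMap, fun u => by
      rw [LinearMap.compr₂_apply, alt, map_zero]⟩, by
    rw [mem_twoCocycle_iff_of_trivial]
    intro u v w
    change (TrivialLieModule.equiv K L K).symm _ = (TrivialLieModule.equiv K L K).symm _ +
      (TrivialLieModule.equiv K L K).symm _
    rw [cyc, map_add]⟩

variable (K L) in
/-- The scalar-valued form underlying a 2-cocycle with trivial coefficients. -/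
noncomputable def formOfCocycle :
    twoCocycle K L (TrivialLieModule K L K) →ₗ[K] L →ₗ[K] L →ₗ[K] K where
  toFun c := c.1.1.compr₂ (TrivialLieModule.equiv K L K).toLinearMap
  map_add' _ _ := rfl
  map_smul' _ _ := rfl

lemma formOfCocycle_apply (c : twoCocycle K L (TrivialLieModule K L K)) (u v : L) :
    formOfCocycle K L c u v = TrivialLieModule.equiv K L K (c.1 u v) := rfl

lemma formOfCocycle_cocycleOfForm (β : L →ₗ[K] L →ₗ[K] K) (alt : ∀ u, β u u = 0)
    (cyc : ∀ u v w, β u ⁅v, w⁆ = β ⁅u, v⁆ w + β v ⁅u, w⁆) :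
    formOfCocycle K L (cocycleOfForm β alt cyc) = β := rfl

lemma formOfCocycle_self (c : twoCocycle K L (TrivialLieModule K L K)) (u : L) :
    formOfCocycle K L c u u = 0 := by
  rw [formOfCocycle_apply, twoCochain_alt, map_zero]

lemma formOfCocycle_lie (c : twoCocycle K L (TrivialLieModule K L K)) (u v w : L) :
    formOfCocycle K L c u ⁅v, w⁆ = formOfCocycle K L c ⁅u, v⁆ w + formOfCocycle K L c v ⁅u, w⁆ := by
  rw [formOfCocycle_apply, (mem_twoCocycle_iff_of_trivial K L (TrivialLieModule K L K) c.1).1 c.2,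
    map_add]
  rfl

lemma mem_twoCoboundary_iff (c : twoCocycle K L (TrivialLieModule K L K)) :
    c ∈ twoCoboundary K L (TrivialLieModule K L K) ↔
      ∃ ℓ : L →ₗ[K] K, ∀ u v, formOfCocycle K L c u v = ℓ ⁅u, v⁆ := by
  rw [twoCoboundary, Submodule.submoduleOf, Submodule.mem_comap]
  constructor
  · rintro ⟨ℓ, hℓ⟩
    refine ⟨-((TrivialLieModule.equiv K L K).toLinearMap ∘ₗ ℓ), fun u v => ?_⟩
    have h1 : c.1 = d₁₂ K L (TrivialLieModule K L K) ℓ := hℓ.symm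
    rw [formOfCocycle_apply, h1, d₁₂_apply_apply_ofTrivial, map_neg]
    rfl
  · rintro ⟨ℓ, hℓ⟩
    refine ⟨-((TrivialLieModule.equiv K L K).symm.toLinearMap ∘ₗ ℓ), ?_⟩
    refine Subtype.ext (LinearMap.ext fun u => LinearMap.ext fun v => ?_)
    change d₁₂ K L (TrivialLieModule K L K) _ u v = _
    rw [d₁₂_apply_apply_ofTrivial, LinearMap.neg_apply, neg_neg, LinearMap.comp_apply, ← hℓ]
    rfl

/-- Cocycles form a basis of `H²` if they are dual to linear functionals on the space of cocycles
whose common kernel consists of the coboundaries. -/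
lemma exists_basis_H2_of_dual {ι : Type*} [Fintype ι] [DecidableEq ι]
    (ev : twoCocycle K L (TrivialLieModule K L K) →ₗ[K] ι → K)
    (hker : LinearMap.ker ev = twoCoboundary K L (TrivialLieModule K L K))
    (z : ι → twoCocycle K L (TrivialLieModule K L K)) (hz : ∀ t, ev (z t) = Pi.single t 1) :
    ∃ B : Module.Basis ι K (H2 K L (TrivialLieModule K L K)),
      ∀ t, B t = Submodule.Quotient.mk (z t) := by
  have hsurj : Function.Surjective ev := by
    rw [← LinearMap.range_eq_top, eq_top_iff, ← (Pi.basisFun K ι).span_eq, Submodule.span_le]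
    rintro _ ⟨t, rfl⟩
    rw [Pi.basisFun_apply]
    exact ⟨z t, hz t⟩
  let E : H2 K L (TrivialLieModule K L K) ≃ₗ[K] (ι → K) :=
    (Submodule.quotEquivOfEq _ _ hker.symm).trans (ev.quotKerEquivOfSurjective hsurj)
  refine ⟨Module.Basis.ofEquivFun E, fun t => ?_⟩
  rw [Module.Basis.coe_ofEquivFun, LinearEquiv.symm_apply_eq]
  exact (hz t).symm

end ScalarCocycles

/-! ### Cohomology of the quotient of divided powers by the constants -/

variable {L : Type*} [LieRing L] [LieAlgebra F L]

/-- A surjective linear map from divided powers to a Lie algebra, with kernel the constants, that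
intertwines `(f, g) ↦ ham f g` with the bracket. -/
structure IsHamQuotient (π : 𝔸 →ₗ[F] L) : Prop where
  lie : ∀ f g, ⁅π f, π g⁆ = π (𝐡 f g)
  ker : ∀ f, π f = 0 ↔ ∃ c : F, f = c • 1
  surj : Function.Surjective π

namespace IsHamQuotient

lemma map_one {π : 𝔸 →ₗ[F] L} (hπ : IsHamQuotient π) : π 1 = 0 :=
  (hπ.ker 1).2 ⟨1, (one_smul F 1).symm⟩

/-- The basis of `L` formed by the monomials other than `1`. -/
noncomputable def basis {π : 𝔸 →ₗ[F] L} (hπ : IsHamQuotient π) :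
    Module.Basis (MonIdx p n₁ n₂) F L :=
  Module.Basis.mk (v := fun a => π (mon F (p ^ n₁) (p ^ n₂) a.1.1 a.1.2))
    (by
      rw [Fintype.linearIndependent_iff]
      intro g hg a
      have h1 : π (∑ b : MonIdx p n₁ n₂, g b • mon F (p ^ n₁) (p ^ n₂) b.1.1 b.1.2) = 0 := by
        simpa only [map_sum, map_smul] using hg
      obtain ⟨c, hc⟩ := (hπ.ker _).1 h1
      have h2 := congrArg (coeffLin F a.1) hc
      simp only [map_sum, map_smul, one_def, coeffLin_mon, smul_eq_mul, mul_ite, mul_one,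
        mul_zero] at h2
      rw [if_neg a.2, Finset.sum_eq_single a, if_pos ⟨rfl, rfl⟩] at h2
      · exact h2
      · intro b _ hb
        refine if_neg fun h => hb ?_
        exact Subtype.ext (Prod.ext (Fin.ext h.1.symm) (Fin.ext h.2.symm))
      · intro h
        exact absurd (Finset.mem_univ a) h)
    (by
      rintro u -
      obtain ⟨f, rfl⟩ := hπ.surj u
      induction f using mon_induction with
      | h_zero => rw [map_zero]; exact zero_mem _
      | h_add f g hf hg => rw [map_add]; exact add_mem hf hg
      | h_smul c f hf => rw [map_smul]; exact Submodule.smul_mem _ c hf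
      | h_mon i j hi hj =>
        by_cases h0 : i = 0 ∧ j = 0
        · rw [h0.1, h0.2, ← one_def, hπ.map_one]
          exact zero_mem _
        · exact Submodule.subset_span ⟨⟨(⟨i, hi⟩, ⟨j, hj⟩), h0⟩, rfl⟩)

lemma basis_apply {π : 𝔸 →ₗ[F] L} (hπ : IsHamQuotient π) (a : MonIdx p n₁ n₂) :
    hπ.basis a = π (𝐦 a.1.1 a.1.2) := by
  rw [basis, Module.Basis.mk_apply]

/-- The section of `π` whose image is spanned by the monomials other than `1`. -/
noncomputable def sec {π : 𝔸 →ₗ[F] L} (hπ : IsHamQuotient π) : L →ₗ[F] 𝔸 :=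
  hπ.basis.constr F fun a => mon F (p ^ n₁) (p ^ n₂) a.1.1 a.1.2

lemma map_sec {π : 𝔸 →ₗ[F] L} (hπ : IsHamQuotient π) (u : L) : π (hπ.sec u) = u := by
  have : π ∘ₗ hπ.sec = LinearMap.id := by
    refine hπ.basis.ext fun a => ?_
    rw [LinearMap.comp_apply, sec, Module.Basis.constr_basis, basis_apply, LinearMap.id_apply]
  exact congrArg (fun g => g u) this

/-- A linear map that kills the constants factors through `π`. -/
lemma map_sec_map {π : 𝔸 →ₗ[F] L} (hπ : IsHamQuotient π) {M : Type*} [AddCommGroup M] [Module F M]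
    {ℓ : 𝔸 →ₗ[F] M} (hℓ : ℓ 1 = 0) (f : 𝔸) : ℓ (hπ.sec (π f)) = ℓ f := by
  obtain ⟨c, hc⟩ := (hπ.ker (hπ.sec (π f) - f)).1 (by rw [map_sub, hπ.map_sec, sub_self])
  rw [← sub_eq_zero, ← map_sub, hc, map_smul, hℓ, smul_zero]

/-- The bilinear form on `L` induced by a form on divided powers. -/
noncomputable def descend {π : 𝔸 →ₗ[F] L} (hπ : IsHamQuotient π) (Φ : 𝔸 →ₗ[F] 𝔸 →ₗ[F] F) :
    L →ₗ[F] L →ₗ[F] F :=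
  Φ.compl₁₂ hπ.sec hπ.sec

lemma descend_map {π : 𝔸 →ₗ[F] L} (hπ : IsHamQuotient π) {Φ : 𝔸 →ₗ[F] 𝔸 →ₗ[F] F}
    (hΦ : IsHamCocycle Φ) (f g : 𝔸) : hπ.descend Φ (π f) (π g) = Φ f g := by
  rw [descend, LinearMap.compl₁₂_apply, hπ.map_sec_map (hΦ.one_right _),
    hπ.map_sec_map (LinearMap.ext hΦ.one_left)]

/-- The 2-cocycle of `L` induced by a cocycle on divided powers. -/
noncomputable def cocycle {π : 𝔸 →ₗ[F] L} (hπ : IsHamQuotient π) {Φ : 𝔸 →ₗ[F] 𝔸 →ₗ[F] F}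
    (hΦ : IsHamCocycle Φ) : twoCocycle F L (TrivialLieModule F L F) :=
  cocycleOfForm (hπ.descend Φ)
    (fun u => by rw [descend, LinearMap.compl₁₂_apply, hΦ.alt])
    (fun u v w => by
      obtain ⟨f, rfl⟩ := hπ.surj u
      obtain ⟨g, rfl⟩ := hπ.surj v
      obtain ⟨h, rfl⟩ := hπ.surj w
      rw [hπ.lie, hπ.lie, hπ.lie, hπ.descend_map hΦ, hπ.descend_map hΦ, hπ.descend_map hΦ]
      have h1 := hΦ.cyclic f g h
      rw [hΦ.skew (𝐡 g h) f, hΦ.skew (𝐡 h f) g, ham_swap h f, map_neg] at h1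
      linear_combination -h1)

lemma formOfCocycle_cocycle {π : 𝔸 →ₗ[F] L} (hπ : IsHamQuotient π) {Φ : 𝔸 →ₗ[F] 𝔸 →ₗ[F] F}
    (hΦ : IsHamCocycle Φ) (f g : 𝔸) :
    formOfCocycle F L (hπ.cocycle hΦ) (π f) (π g) = Φ f g := by
  rw [cocycle, formOfCocycle_cocycleOfForm, hπ.descend_map hΦ]

/-- Cocycles of `L` pull back to cocycles on divided powers. -/
lemma isHamCocycle_pullback {π : 𝔸 →ₗ[F] L} (hπ : IsHamQuotient π)
    (c : twoCocycle F L (TrivialLieModule F L F)) :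
    IsHamCocycle ((formOfCocycle F L c).compl₁₂ π π) where
  alt f := formOfCocycle_self c _
  one_left f := by
    rw [LinearMap.compl₁₂_apply, hπ.map_one, map_zero, LinearMap.zero_apply]
  cyclic f g h := by
    have h1 := formOfCocycle_lie c (π f) (π g) (π h)
    rw [hπ.lie, hπ.lie, hπ.lie] at h1
    simp only [LinearMap.compl₁₂_apply]
    rw [ham_swap h f, map_neg, map_neg, LinearMap.neg_apply,
      neg_eq_of_alternating (formOfCocycle_self c) (π (𝐡 g h)),
      neg_eq_of_alternating (formOfCocycle_self c) (π (𝐡 f h))]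
    linear_combination -h1

/-- The values of a cocycle that determine its cohomology class: those on the pairs
`(y, y^(p^r - 1))`, up to sign, and `(x, x^(p^s - 1))`. -/
noncomputable def obstruction (π : 𝔸 →ₗ[F] L) :
    twoCocycle F L (TrivialLieModule F L F) →ₗ[F] (Set.Ioc 0 n₂ ⊕ Set.Ioc 0 n₁ → F) where
  toFun c := Sum.elim
    (fun r => -formOfCocycle F L c (π (𝐦 0 1)) (π (𝐦 0 (p ^ r.1 - 1))))
    (fun s => formOfCocycle F L c (π (𝐦 1 0)) (π (𝐦 (p ^ s.1 - 1) 0)))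
  map_add' c d := by
    funext t
    rcases t with r | s
    · exact neg_add _ _
    · rfl
  map_smul' a c := by
    funext t
    rcases t with r | s
    · exact (mul_neg _ _).symm
    · rfl

lemma obstruction_inl (π : 𝔸 →ₗ[F] L) (c : twoCocycle F L (TrivialLieModule F L F))
    (r : Set.Ioc 0 n₂) : obstruction π c (Sum.inl r) =
      -formOfCocycle F L c (π (𝐦 0 1)) (π (𝐦 0 (p ^ r.1 - 1))) := rfl

lemma obstruction_inr (π : 𝔸 →ₗ[F] L) (c : twoCocycle F L (TrivialLieModule F L F))
    (s : Set.Ioc 0 n₁) : obstruction π c (Sum.inr s) =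
      formOfCocycle F L c (π (𝐦 1 0)) (π (𝐦 (p ^ s.1 - 1) 0)) := rfl

lemma ker_obstruction [NeZero n₁] [NeZero n₂] (hp : Odd p) {π : 𝔸 →ₗ[F] L}
    (hπ : IsHamQuotient π) :
    LinearMap.ker (obstruction π) = twoCoboundary F L (TrivialLieModule F L F) := by
  ext c
  rw [LinearMap.mem_ker, mem_twoCoboundary_iff]
  constructor
  · intro hc
    have hΦ := hπ.isHamCocycle_pullback c
    obtain ⟨ℓ, hℓ1, hℓ⟩ := hΦ.exists_eq_ham hp
      (fun j => by
        by_cases hj : ∃ r, 0 < r ∧ r ≤ n₂ ∧ j + 1 = p ^ r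
        · obtain ⟨r, hr0, hr, hjr⟩ := hj
          obtain rfl : j = p ^ r - 1 := by omega
          exact neg_eq_zero.1 (congrFun hc (Sum.inl ⟨r, hr0, hr⟩))
        · exact hΦ.y_pow_eq_zero fun r hr0 hr h => hj ⟨r, hr0, hr, h⟩)
      (fun i => by
        by_cases hi : ∃ s, 0 < s ∧ s ≤ n₁ ∧ i + 1 = p ^ s
        · obtain ⟨s, hs0, hs, his⟩ := hi
          obtain rfl : i = p ^ s - 1 := by omega
          exact congrFun hc (Sum.inr ⟨s, hs0, hs⟩)
        · exact hΦ.x_pow_eq_zero fun s hs0 hs h => hi ⟨s, hs0, hs, h⟩)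
    refine ⟨ℓ ∘ₗ hπ.sec, fun u v => ?_⟩
    obtain ⟨f, rfl⟩ := hπ.surj u
    obtain ⟨g, rfl⟩ := hπ.surj v
    rw [hπ.lie, LinearMap.comp_apply, hπ.map_sec_map hℓ1, ← hℓ, LinearMap.compl₁₂_apply]
  · rintro ⟨ℓ, hℓ⟩
    have hval : ∀ f g : 𝔸, 𝐡 f g = 0 → formOfCocycle F L c (π f) (π g) = 0 := by
      intro f g hfg
      rw [hℓ, hπ.lie, hfg, map_zero, map_zero]
    funext t
    rcases t with r | s
    · rw [obstruction_inl, hval _ _ (ham_y_mon_zero _), neg_zero, Pi.zero_apply]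
    · rw [obstruction_inr, hval _ _ (ham_x_mon_zero _), Pi.zero_apply]

section Cocycles

variable [NeZero n₁] [NeZero n₂]

/-- The cocycle `φ_r`. -/
noncomputable def phi (hp : Odd p) {π : 𝔸 →ₗ[F] L} (hπ : IsHamQuotient π) (r : ℕ) :
    twoCocycle F L (TrivialLieModule F L F) :=
  hπ.cocycle (isHamCocycle_powForm hp (𝐦 1 0) r)

/-- The cocycle `ψ_s`. -/
noncomputable def psi (hp : Odd p) {π : 𝔸 →ₗ[F] L} (hπ : IsHamQuotient π) (s : ℕ) :
    twoCocycle F L (TrivialLieModule F L F) :=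
  hπ.cocycle (isHamCocycle_powForm hp (𝐦 0 1) s)

lemma phi_mon (hp : Odd p) {π : 𝔸 →ₗ[F] L} (hπ : IsHamQuotient π) {r : ℕ} (hr : r ≤ n₂)
    {i j k l : ℕ} (hi : i < p ^ n₁) (hj : j < p ^ n₂) (hk : k < p ^ n₁) (hl : l < p ^ n₂)
    (hij : ¬(i = 0 ∧ j = 0)) (hkl : ¬(k = 0 ∧ l = 0)) :
    formOfCocycle F L (hπ.phi hp r) (π (𝐦 i j)) (π (𝐦 k l)) = phiValue F p n₁ n₂ r i j k l := by
  rw [phi, formOfCocycle_cocycle, powForm_x_mon hp hr hi hj hk hl hij hkl]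

lemma psi_mon (hp : Odd p) {π : 𝔸 →ₗ[F] L} (hπ : IsHamQuotient π) {s : ℕ} (hs : s ≤ n₁)
    {i j k l : ℕ} (hi : i < p ^ n₁) (hj : j < p ^ n₂) (hk : k < p ^ n₁) (hl : l < p ^ n₂)
    (hij : ¬(i = 0 ∧ j = 0)) (hkl : ¬(k = 0 ∧ l = 0)) :
    formOfCocycle F L (hπ.psi hp s) (π (𝐦 i j)) (π (𝐦 k l)) = psiValue F p n₁ n₂ s i j k l := by
  rw [psi, formOfCocycle_cocycle, powForm_y_mon hp hs hi hj hk hl hij hkl]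

variable (p) in
lemma pow_bounds {n : ℕ} (r : Set.Ioc 0 n) : 1 < p ^ r.1 ∧ p ^ r.1 ≤ p ^ n :=
  ⟨Nat.one_lt_pow r.2.1.ne' (Fact.out : p.Prime).one_lt,
    Nat.pow_le_pow_right (Fact.out : p.Prime).pos r.2.2⟩

lemma obstruction_phi (hp : Odd p) {π : 𝔸 →ₗ[F] L} (hπ : IsHamQuotient π) (r : Set.Ioc 0 n₂) :
    obstruction π (hπ.phi hp r.1) = Pi.single (Sum.inl r) 1 := by
  have q1 := one_lt_pow_of_neZero p n₁
  have q2 := one_lt_pow_of_neZero p n₂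
  have hr := pow_bounds p r
  funext t
  rcases t with t | t
  · have ht := pow_bounds p t
    rw [obstruction_inl]
    have hD := degCongr_iff (p := p) (n₁ := n₁) (n₂ := n₂) (i := 0) (j := 1) (k := 0)
      (l := p ^ t.1 - 1) (N := p ^ r.1) (by omega) q2 (by omega) (by omega) (by omega)
    rw [Nat.cast_pow] at hD
    rw [hπ.phi_mon hp r.2.2 (by omega) q2 (by omega) (by omega) (by omega) (by omega), phiValue, hD,
      Pi.single_apply]
    by_cases htr : t = r
    · rw [htr, if_pos (by omega), if_pos rfl]
      ring
    · have hne : p ^ t.1 ≠ p ^ r.1 := fun h =>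
        htr (Subtype.ext (Nat.pow_right_injective (Fact.out : p.Prime).two_le h))
      rw [if_neg (by omega), if_neg (by simpa using htr), neg_zero]
  · have ht := pow_bounds p t
    rw [obstruction_inr]
    have hD := degCongr_iff (p := p) (n₁ := n₁) (n₂ := n₂) (i := 1) (j := 0)
      (k := p ^ t.1 - 1) (l := 0) (N := p ^ r.1) q1 (by omega) (by omega) (by omega) (by omega)
    rw [Nat.cast_pow] at hD
    rw [hπ.phi_mon hp r.2.2 q1 (by omega) (by omega) (by omega) (by omega) (by omega), phiValue, hD,
      if_neg (by omega), Pi.single_apply, if_neg (by simp)]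

lemma obstruction_psi (hp : Odd p) {π : 𝔸 →ₗ[F] L} (hπ : IsHamQuotient π) (s : Set.Ioc 0 n₁) :
    obstruction π (hπ.psi hp s.1) = Pi.single (Sum.inr s) 1 := by
  have q1 := one_lt_pow_of_neZero p n₁
  have q2 := one_lt_pow_of_neZero p n₂
  have hs := pow_bounds p s
  funext t
  rcases t with t | t
  · have ht := pow_bounds p t
    rw [obstruction_inl]
    have hD := degCongr_iff (p := p) (n₁ := n₂) (n₂ := n₁) (i := 1) (j := 0)
      (k := p ^ t.1 - 1) (l := 0) (N := p ^ s.1) q2 (by omega) (by omega) (by omega) (by omega)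
    rw [← degCongr_swap, Nat.cast_pow] at hD
    rw [hπ.psi_mon hp s.2.2 (by omega) q2 (by omega) (by omega) (by omega) (by omega), psiValue, hD,
      if_neg (by omega), Pi.single_apply, if_neg (by simp), neg_zero]
  · have ht := pow_bounds p t
    rw [obstruction_inr]
    have hD := degCongr_iff (p := p) (n₁ := n₂) (n₂ := n₁) (i := 0) (j := 1) (k := 0)
      (l := p ^ t.1 - 1) (N := p ^ s.1) (by omega) q1 (by omega) (by omega) (by omega)
    rw [← degCongr_swap, Nat.cast_pow] at hD
    rw [hπ.psi_mon hp s.2.2 q1 (by omega) (by omega) (by omega) (by omega) (by omega), psiValue, hD,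
      Pi.single_apply]
    by_cases hts : t = s
    · rw [hts, if_pos (by omega), if_pos rfl]
      ring
    · have hne : p ^ t.1 ≠ p ^ s.1 := fun h =>
        hts (Subtype.ext (Nat.pow_right_injective (Fact.out : p.Prime).two_le h))
      rw [if_neg (by omega), if_neg (by simpa using hts)]

/-- Description of the second cohomology group for every presentation of the Lie algebra as a
quotient of divided powers. -/
lemma exists_basis_H2 (hp : Odd p) {π : 𝔸 →ₗ[F] L} (hπ : IsHamQuotient π) :
    ∃ m : Module.Basis (MonIdx p n₁ n₂) F L, (∀ a, m a = π (𝐦 a.1.1 a.1.2)) ∧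
      ∃ (φ : Set.Ioc 0 n₂ → twoCocycle F L (TrivialLieModule F L F))
        (ψ : Set.Ioc 0 n₁ → twoCocycle F L (TrivialLieModule F L F)),
        (∀ (r : Set.Ioc 0 n₂) (a b : MonIdx p n₁ n₂),
          TrivialLieModule.equiv F L F ((φ r).1 (m a) (m b)) =
            phiValue F p n₁ n₂ r a.1.1 a.1.2 b.1.1 b.1.2) ∧
        (∀ (s : Set.Ioc 0 n₁) (a b : MonIdx p n₁ n₂),
          TrivialLieModule.equiv F L F ((ψ s).1 (m a) (m b)) =
            psiValue F p n₁ n₂ s a.1.1 a.1.2 b.1.1 b.1.2) ∧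
        Module.finrank F (H2 F L (TrivialLieModule F L F)) = n₁ + n₂ ∧
        ∃ B : Module.Basis (Set.Ioc 0 n₂ ⊕ Set.Ioc 0 n₁) F (H2 F L (TrivialLieModule F L F)),
          (∀ r : Set.Ioc 0 n₂, B (Sum.inl r) = Submodule.Quotient.mk (φ r)) ∧
          (∀ s : Set.Ioc 0 n₁, B (Sum.inr s) = Submodule.Quotient.mk (ψ s)) := by
  obtain ⟨B, hB⟩ := exists_basis_H2_of_dual (obstruction π) (hπ.ker_obstruction hp)
    (Sum.elim (fun r => hπ.phi hp r.1) (fun s => hπ.psi hp s.1)) (by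
      rintro (r | s)
      · exact hπ.obstruction_phi hp r
      · exact hπ.obstruction_psi hp s)
  refine ⟨hπ.basis, hπ.basis_apply, fun r => hπ.phi hp r.1, fun s => hπ.psi hp s.1,
    fun r a b => ?_, fun s a b => ?_, ?_, B, fun r => hB (Sum.inl r), fun s => hB (Sum.inr s)⟩
  · rw [basis_apply, basis_apply]
    exact hπ.phi_mon hp r.2.2 a.1.1.2 a.1.2.2 b.1.1.2 b.1.2.2 a.2 b.2
  · rw [basis_apply, basis_apply]
    exact hπ.psi_mon hp s.2.2 a.1.1.2 a.1.2.2 b.1.1.2 b.1.2.2 a.2 b.2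
  · rw [Module.finrank_eq_card_basis B]
    simp [add_comm]

end Cocycles

end IsHamQuotient

/-- The Hamiltonian algebra is the quotient of divided powers by the constants. -/
lemma isHamQuotient_hamL [NeZero n₁] [NeZero n₂] : IsHamQuotient (hamL F p n₁ n₂) where
  lie := hamL_lie
  ker := hamL_eq_zero_iff
  surj := hamL_surjective

end HamiltonianLie

open HamiltonianLie LieModule.Cohomology in
theorem mainTheorem1 (F : Type*) [Field F] (p : ℕ) [Fact p.Prime] [CharP F p] (hp : Odd p)
    (n₁ n₂ : ℕ) (hn₁ : 0 < n₁) (hn₂ : 0 < n₂) :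
    ∃ m : Module.Basis (MonIdx p n₁ n₂) F (H F p n₁ n₂),
      (∀ a : MonIdx p n₁ n₂,
        ((m a : HTilde F p n₁ n₂) : Derivation F (DP F p n₁ n₂) (DP F p n₁ n₂)) =
          ham F p n₁ n₂ (mon F (p ^ n₁) (p ^ n₂) a.1.1 a.1.2)) ∧
      ∃ (φ : Set.Ioc 0 n₂ → twoCocycle F (H F p n₁ n₂) (Triv F p n₁ n₂))
        (ψ : Set.Ioc 0 n₁ → twoCocycle F (H F p n₁ n₂) (Triv F p n₁ n₂)),
        (∀ (r : Set.Ioc 0 n₂) (a b : MonIdx p n₁ n₂),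
          TrivialLieModule.equiv F (H F p n₁ n₂) F ((φ r).1 (m a) (m b)) =
            phiValue F p n₁ n₂ r a.1.1 a.1.2 b.1.1 b.1.2) ∧
        (∀ (s : Set.Ioc 0 n₁) (a b : MonIdx p n₁ n₂),
          TrivialLieModule.equiv F (H F p n₁ n₂) F ((ψ s).1 (m a) (m b)) =
            psiValue F p n₁ n₂ s a.1.1 a.1.2 b.1.1 b.1.2) ∧
        Module.finrank F (H2 F (H F p n₁ n₂) (Triv F p n₁ n₂)) = n₁ + n₂ ∧
        ∃ B : Module.Basis (Set.Ioc 0 n₂ ⊕ Set.Ioc 0 n₁) F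
            (H2 F (H F p n₁ n₂) (Triv F p n₁ n₂)),
          (∀ r : Set.Ioc 0 n₂, B (Sum.inl r) = Submodule.Quotient.mk (φ r)) ∧
          (∀ s : Set.Ioc 0 n₁, B (Sum.inr s) = Submodule.Quotient.mk (ψ s)) := by
  have : NeZero n₁ := ⟨hn₁.ne'⟩
  have : NeZero n₂ := ⟨hn₂.ne'⟩
  exact ((isHamQuotient_hamL (F := F) (p := p) (n₁ := n₁) (n₂ := n₂)).exists_basis_H2 hp).imp
    fun m hm => ⟨fun a =>
      (congrArg (fun D : H F p n₁ n₂ => (D : HTilde F p n₁ n₂).1) (hm.1 a)).trans (hamL_coe _),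
      hm.2⟩
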